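/- Let $\mathbf{G}(n,d)$ be the uniform distribution over simple $d$-regular graphs on the vertex set $[n]$ (where $nd$ is even), and let $\mathcal U$ be the random walk on $G$ from vertex $1$. A randomized algorithm $\mathcal A$ with probe access to $G$ keeps an internal state; when queried at a time $t\in\{0,\dots,n\}$ it may toss coins and make $\textsc{rand\_neighbor}$ probes (which return a uniformly random neighbor of a vertex of its choice) and $\textsc{rand\_vertex}$ probes (which return a uniformly random vertex), and it then returns a vertex $v_t$. The transcript consists of the queries made so far with the returned vertices, in order, and the set of edges revealed by the $\textsc{rand\_neighbor}$ probes. An adaptive query sequence $Q$ is a deterministic function that maps each transcript to the next query time, one not queried before, or stops. Let $D_{G,\mathcal A,Q}$ be the distribution of the responses of $\mathcal A$ with probe access to $G$ on $Q$, as a partially determined vertex sequence in $([n]\cup\{*\})^{\{0,\dots,n\}}$. For a function $F$ with values in $\{0,1\}$ and a distribution $D$ on such sequences, write $F(D)=\mathbb E_{x\sim D}F(x)$. Denote by $P_{Q}(\mathcal U)$ the distribution of the positions of a true random walk $\sigma\leftarrow\mathcal U$ of length $n$ in $G$ at a set of observed times. Since the times queried by an adaptive sequence depend on the answers, this set is allowed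 to be generated in any way, possibly at random, depending on $G$ and on $\sigma$; the statements hold for each such choice, as indicated below. **Theorem.** There is an absolute constant $C$ such that for each $d\ge 3$ there are constants $q_d>0$ and $n_0$, depending only on $d$, such that for all $n\ge n_0$ with $nd$ even there exist functions $F_G:([n]\cup\{*\})^{\{0,\dots,n\}}\to\{0,1\}$, one for each graph $G$ on $[n]$, and an adaptive query sequence $Q$ of at most $C\log n$ queries, neither depending on the algorithm, such that the following holds for every (possibly randomized) algorithm $\mathcal A$ with $\textsc{rand\_neighbor}$ and $\textsc{rand\_vertex}$ probe access. 1. If $\mathcal A$ makes fewer than $\sqrt n/(q_d\log n)$ probes per query, then for every choice of $P_Q(\mathcal U)$ as above $$\mathbb{E}_{G\leftarrow \mathbf{G}(n,d)}\bigl|F_{G}(P_{Q}(\mathcal U)) - F_{G}(D_{G,\mathcal A,Q})\bigr|\ge 0.99 .$$ 2. Consequently, if $\mathbb{E}_{G\leftarrow \mathbf{G}(n,d)}\|D_{G,\mathcal A,Q}-P_{Q}(\mathcal U)\|_1\le 0.99$ for some choice of $P_Q(\mathcal U)$ as above, then it is not the case that $\mathcal A$ makes fewer than $\sqrt n/(q_d\log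 n)$ probes per query; that is, robust algorithms need $\Omega(\sqrt n/\log n)$ probes per query. -/

import Mathlib

noncomputable section

namespace WalkAccess

/-! ### Graphs, probes and true random walks -/

open Classical in
/-- The finite set of simple `d`-regular graphs on the vertex set `Fin n`. -/
def regularGraphs (n d : ℕ) : Finset (SimpleGraph (Fin n)) :=
  Finset.univ.filter fun G => G.IsRegularOfDegree d

/-- Expectation of `f G` for `G` uniform among the `d`-regular graphs on `n` vertices. -/
def expectRegular (n d : ℕ) (f : SimpleGraph (Fin n) → ℝ) : ℝ :=
  (∑ G ∈ regularGraphs n d, f G) / ((regularGraphs n d).card : ℝ)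

open Classical in
/-- A uniformly random neighbour of `v`. (At an isolated vertex, which does not occur in a
regular graph of positive degree, the value is `v` itself.) -/
def randNeighbor {n : ℕ} (G : SimpleGraph (Fin n)) (v : Fin n) : PMF (Fin n) :=
  if h : (G.neighborFinset v).Nonempty then PMF.uniformOfFinset (G.neighborFinset v) h
  else PMF.pure v

/-- The random walk of length `l` in `G` from the first vertex, as a distribution on the
sequence of its positions at the times `0, …, l`. -/
def walk {n : ℕ} [NeZero n] (G : SimpleGraph (Fin n)) : (l : ℕ) → PMF (Fin (l + 1) → Fin n)
  | 0 => PMF.pure fun _ => 0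
  | l + 1 => (walk G l).bind fun σ =>
      (randNeighbor G (σ (Fin.last l))).map fun w =>
        Fin.snoc (α := fun _ => Fin n) σ w

/-- Query times; they are restricted to `0, …, n`. -/
abbrev Time (n : ℕ) : Type := Fin (n + 1)

/-- Partially determined vertex sequences: `none` stands for an undetermined position. -/
abbrev PartialWalk (n : ℕ) : Type := Time n → Option (Fin n)

/-- The projection of the sequence `σ` to the times in `T`. -/
def project {n : ℕ} (σ : Time n → Fin n) (T : Finset (Time n)) : PartialWalk n :=
  fun t => if t ∈ T then some (σ t) else none

/-- A rule for the set of times at which a walk is observed: given the whole walk it returns a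
distribution on sets of times. Constant rules with value `PMF.pure T` observe at a fixed set `T`;
constant rules in general observe at random times that are independent of the walk. -/
abbrev TimeRule (n : ℕ) : Type := (Time n → Fin n) → PMF (Finset (Time n))

/-- The positions of a true random walk in `G` at times chosen by the rule `τ`. -/
def trueAnswers {n : ℕ} [NeZero n] (G : SimpleGraph (Fin n)) (τ : TimeRule n) :
    PMF (PartialWalk n) :=
  (walk G n).bind fun σ => (τ σ).map (project σ)

/-! ### Randomized algorithms with probe access -/

/-- A randomized computation with probe access to a graph on `Fin n`, with result in `α`:
it may return, toss a coin of an arbitrary discrete law, ask for a random neighbour of a vertex,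
or ask for a random vertex, and go on depending on the outcome. -/
inductive ProbeComp (n : ℕ) (α : Type) : Type
  | ret (a : α) : ProbeComp n α
  | coin (p : PMF ℕ) (k : ℕ → ProbeComp n α) : ProbeComp n α
  | neighborProbe (v : Fin n) (k : Fin n → ProbeComp n α) : ProbeComp n α
  | vertexProbe (k : Fin n → ProbeComp n α) : ProbeComp n α

/-- The computation makes at most `m` probes, whatever the coins and the replies. -/
def ProbeComp.ProbesAtMost {n : ℕ} {α : Type} : ProbeComp n α → ℕ → Prop
  | .ret _, _ => True
  | .coin _ k, m => ∀ i, (k i).ProbesAtMost m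
  | .neighborProbe _ _, 0 => False
  | .neighborProbe _ k, m + 1 => ∀ w, (k w).ProbesAtMost m
  | .vertexProbe _, 0 => False
  | .vertexProbe k, m + 1 => ∀ w, (k w).ProbesAtMost m

/-- Joint law of the result and of the set of revealed edges when the computation is run on `G`,
`S` being the set of edges revealed before. -/
def ProbeComp.run {n : ℕ} [NeZero n] {α : Type} (G : SimpleGraph (Fin n)) :
    ProbeComp n α → Finset (Sym2 (Fin n)) → PMF (α × Finset (Sym2 (Fin n)))
  | .ret a, S => PMF.pure (a, S)
  | .coin p k, S => p.bind fun i => (k i).run G S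
  | .neighborProbe v k, S =>
      (randNeighbor G v).bind fun w => (k w).run G (insert s(v, w) S)
  | .vertexProbe k, S => (PMF.uniformOfFintype (Fin n)).bind fun w => (k w).run G S

/-- A (possibly randomized) algorithm that answers queries for the position of a walk:
from its current internal state and the queried time it computes, by means of probes,
the returned vertex and its next internal state. -/
structure Algorithm (n : ℕ) where
  State : Type
  start : State
  respond : State → Time n → ProbeComp n (Fin n × State)

/-- The algorithm makes fewer than `b` probes per query. -/
def Algorithm.ProbesFewerThan {n : ℕ} (A : Algorithm n) (b : ℝ) : Prop :=
  ∃ m : ℕ, (m : ℝ) < b ∧ ∀ s t, (A.respond s t).ProbesAtMost m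

/-! ### Adaptive query sequences -/

/-- A transcript: the queried times with the returned vertices, in the order of the queries,
and the set of edges revealed by the random neighbour probes. -/
structure Transcript (n : ℕ) where
  answers : List (Time n × Fin n)
  revealed : Finset (Sym2 (Fin n))

/-- The partially determined vertex sequence given by the returned vertices. -/
def Transcript.toPartialWalk {n : ℕ} (tr : Transcript n) : PartialWalk n :=
  fun t => tr.answers.lookup t

/-- An adaptive query sequence: the next query is a function of the transcript (`none` ends the
sequence), it is never a time that was queried before, and there are at most `maxQueries`
queries. -/
structure AdaptiveSequence (n : ℕ) where
  next : Transcript n → Option (Time n)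
  fresh : ∀ tr t, next tr = some t → t ∉ tr.answers.map Prod.fst
  maxQueries : ℕ

/-- Law of the final transcript when at most `r` more queries of `Q` are put to the algorithm `A`
with probe access to `G`, from a given state and transcript. -/
def interact {n : ℕ} [NeZero n] (G : SimpleGraph (Fin n)) (A : Algorithm n)
    (Q : AdaptiveSequence n) : ℕ → A.State → Transcript n → PMF (Transcript n)
  | 0, _, tr => PMF.pure tr
  | r + 1, s, tr =>
      match Q.next tr with
      | none => PMF.pure tr
      | some t => ((A.respond s t).run G tr.revealed).bind fun x =>
          interact G A Q r x.1.2 ⟨tr.answers ++ [(t, x.1.1)], x.2⟩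

/-- The distribution of the responses of `A`, with probe access to `G`, to the sequence `Q`. -/
def responses {n : ℕ} [NeZero n] (G : SimpleGraph (Fin n)) (A : Algorithm n)
    (Q : AdaptiveSequence n) : PMF (PartialWalk n) :=
  (interact G A Q Q.maxQueries A.start ⟨[], ∅⟩).map Transcript.toPartialWalk

/-! ### Comparison of distributions -/

/-- The expectation of the `{0,1}`-valued function `F` under `P`. -/
def evalDist {n : ℕ} (F : PartialWalk n → Bool) (P : PMF (PartialWalk n)) : ℝ :=
  ((P.map F) true).toReal

/-- The `ℓ₁` distance of two distributions. -/
def l1Dist {n : ℕ} (P P' : PMF (PartialWalk n)) : ℝ :=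
  ∑ x, |(P x).toReal - (P' x).toReal|

end WalkAccess

end

noncomputable section

namespace WalkAccess

open Finset SimpleGraph
open scoped ENNReal NNReal

/-! ### Expectations of nonnegative functions -/

/-! The basic estimate comes from switchings (`card_containing_insert_le`, `edgeUnlikely`): in a
uniform regular graph conditioned to contain a set `S` of at most `n / 2` edges, each pair outside
`S` is an edge with probability at most `2 * d / n`. A random neighbour probe keeps the conditional
law uniform on the graphs that contain the revealed edges (`sum_containing_randNeighbor`). Hence,
while the number of probes in total is a small multiple of `√n`, with probability near one each
newly revealed edge leads to a vertex not seen before (`sum_run_le`). The revealed graph is then a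
forest grown by pendant edges, and later probes do not alter distances or separation among the
vertices seen earlier (`Pendant.dist_eq`, `Pendant.separates_iff`).

By the same estimate the first `L` steps of a true walk, `L` being about `√n / 40` up to a factor of
two, trace a tree. Since `d ≥ 3`, a step back in the tree has probability at most `1 / 3`, so the
depth grows with speed at least `1 / 10` on all time scales above a multiple of `log n`
(`sum_not_goodWalk_le`). The test rejects the partial walks that do not extend to a walk in `G` with
this property; true answers pass with high probability at whatever times they are observed.

An algorithm with few probes reveals at most `L / 20` edges, so in the revealed forest the vertex
returned for time `L` is within `L / 20` of the origin. Halving finds a window of logarithmic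
length, starting at a time `s`, in which the distance from the origin grows with slope at most `1 /
20`. If all steps in the window are revealed edges, a walk that escapes with speed `1 / 10` can be
this slow only by approaching the origin first: at a time at least `s + r` it meets a vertex `b`
that separates its position at time `s` from the origin (`exists_separates_of_slow`). To get behind
`b` by time `s` along revealed edges, the walk must have visited `b` before, which linear escape
forbids. Bisection of the times up to `s` locates the step that passes behind `b`. So plausible
answers to these `O(log n)` queries contain two consecutive positions that form an unrevealed edge
of `G` (`QueryTree.search_finished`). Only `O(log² n)` pairs of returned vertices exist, and each is
an unrevealed edge with probability at most `2 * d / n` (`sum_plausible_le`). -/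

/-- Expectation of a nonnegative function under a discrete distribution. -/
def expect {α : Type*} (p : PMF α) (f : α → ℝ≥0∞) : ℝ≥0∞ := ∑' a, p a * f a

theorem expect_pure {α : Type*} (a : α) (f : α → ℝ≥0∞) : expect (PMF.pure a) f = f a := by
  classical
  unfold expect
  rw [tsum_eq_single a]
  · simp
  · intro b hb
    simp [PMF.pure_apply, hb]

theorem expect_bind {α β : Type*} (p : PMF α) (g : α → PMF β) (f : β → ℝ≥0∞) :
    expect (p.bind g) f = expect p fun a => expect (g a) f := by
  unfold expect
  simp_rw [PMF.bind_apply, ← ENNReal.tsum_mul_right, ← ENNReal.tsum_mul_left]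
  rw [ENNReal.tsum_comm]
  simp_rw [mul_assoc]

theorem expect_map {α β : Type*} (p : PMF α) (g : α → β) (f : β → ℝ≥0∞) :
    expect (p.map g) f = expect p fun a => f (g a) := by
  unfold PMF.map
  rw [expect_bind]
  simp [expect_pure]

theorem expect_mono {α : Type*} (p : PMF α) {f g : α → ℝ≥0∞} (h : ∀ a, f a ≤ g a) :
    expect p f ≤ expect p g :=
  ENNReal.tsum_le_tsum fun a => mul_le_mul_right (h a) _

theorem expect_mono_support {α : Type*} (p : PMF α) {f g : α → ℝ≥0∞}
    (h : ∀ a ∈ p.support, f a ≤ g a) : expect p f ≤ expect p g := by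
  refine ENNReal.tsum_le_tsum fun a => ?_
  by_cases ha : p a = 0
  · simp [ha]
  · exact mul_le_mul_right (h a ((PMF.mem_support_iff _ _).2 ha)) _

theorem expect_const {α : Type*} (p : PMF α) (c : ℝ≥0∞) : expect p (fun _ => c) = c := by
  unfold expect
  rw [ENNReal.tsum_mul_right, PMF.tsum_coe, one_mul]

theorem expect_add {α : Type*} (p : PMF α) (f g : α → ℝ≥0∞) :
    expect p (fun a => f a + g a) = expect p f + expect p g := by
  unfold expect
  simp_rw [mul_add]
  exact ENNReal.tsum_add

theorem expect_mul_left {α : Type*} (p : PMF α) (c : ℝ≥0∞) (f : α → ℝ≥0∞) :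
    expect p (fun a => c * f a) = c * expect p f := by
  unfold expect
  rw [← ENNReal.tsum_mul_left]
  simp_rw [mul_left_comm]

theorem expect_finset_sum {α ι : Type*} (p : PMF α) (s : Finset ι) (f : ι → α → ℝ≥0∞) :
    expect p (fun a => ∑ i ∈ s, f i a) = ∑ i ∈ s, expect p (f i) := by
  classical
  induction s using Finset.induction_on with
  | empty => simp [expect]
  | insert i s hi ih => simp_rw [Finset.sum_insert hi]; rw [expect_add, ih]

theorem expect_le_one {α : Type*} (p : PMF α) {f : α → ℝ≥0∞} (h : ∀ a, f a ≤ 1) :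
    expect p f ≤ 1 :=
  (expect_mono p h).trans_eq (expect_const p 1)

open Classical in
/-- The indicator of a proposition. -/
def ind (P : Prop) : ℝ≥0∞ := if P then 1 else 0

theorem ind_le_one (P : Prop) : ind P ≤ 1 := by unfold ind; split_ifs <;> simp

theorem ind_of {P : Prop} (h : P) : ind P = 1 := if_pos h

theorem ind_of_not {P : Prop} (h : ¬P) : ind P = 0 := if_neg h

theorem ind_mono {P Q : Prop} (h : P → Q) : ind P ≤ ind Q := by
  by_cases hP : P
  · rw [ind_of (h hP)]; exact ind_le_one P
  · rw [ind_of_not hP]; exact zero_le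

theorem ind_or_le (P Q : Prop) : ind (P ∨ Q) ≤ ind P + ind Q := by
  by_cases hP : P
  · rw [ind_of hP]; exact (ind_le_one _).trans le_self_add
  · exact (ind_mono fun h => h.resolve_left hP).trans le_add_self

theorem ind_exists_le {ι : Type*} (s : Finset ι) (P : ι → Prop) :
    ind (∃ i ∈ s, P i) ≤ ∑ i ∈ s, ind (P i) := by
  by_cases h : ∃ i ∈ s, P i
  · obtain ⟨i, hi, hP⟩ := h
    refine (ind_le_one _).trans ?_
    rw [← ind_of hP]
    exact Finset.single_le_sum (f := fun i => ind (P i)) (fun _ _ => zero_le) hi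
  · rw [ind_of_not h]; exact zero_le

theorem map_apply_eq_expect {α β : Type*} (p : PMF α) (g : α → β) (b : β) :
    (p.map g) b = expect p fun a => ind (g a = b) := by
  rw [PMF.map_apply]
  unfold expect
  refine tsum_congr fun a => ?_
  by_cases h : g a = b <;> dsimp only
  · rw [if_pos h.symm, ind_of h, mul_one]
  · rw [if_neg (Ne.symm h), ind_of_not h, mul_zero]

/-! ### Regular graphs containing given edges -/

open Classical in
/-- The `d`-regular graphs that contain all the edges in `S`. -/
def containing (n d : ℕ) (S : Finset (Sym2 (Fin n))) : Finset (SimpleGraph (Fin n)) :=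
  (regularGraphs n d).filter fun G => (S : Set (Sym2 (Fin n))) ⊆ G.edgeSet

open Classical in
theorem mem_regularGraphs {n d : ℕ} {G : SimpleGraph (Fin n)} :
    G ∈ regularGraphs n d ↔ G.IsRegularOfDegree d := by
  unfold regularGraphs
  rw [Finset.mem_filter]
  simp only [Finset.mem_univ, true_and]

open Classical in
theorem mem_containing {n d : ℕ} {S : Finset (Sym2 (Fin n))} {G : SimpleGraph (Fin n)} :
    G ∈ containing n d S ↔ G ∈ regularGraphs n d ∧ ∀ e ∈ S, e ∈ G.edgeSet := by
  unfold containing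
  rw [Finset.mem_filter]
  rfl

theorem mem_containing_insert {n d : ℕ} {S : Finset (Sym2 (Fin n))} {G : SimpleGraph (Fin n)}
    {v w : Fin n} : G ∈ containing n d (insert s(v, w) S) ↔ G ∈ containing n d S ∧ G.Adj v w := by
  rw [mem_containing, mem_containing, Finset.forall_mem_insert, SimpleGraph.mem_edgeSet]
  tauto

theorem containing_empty (n d : ℕ) : containing n d ∅ = regularGraphs n d := by
  ext G; simp [mem_containing]

/-- The switching that replaces the edges `uw`, `xy` by `ux`, `wy`. -/
def switch {n : ℕ} (G : SimpleGraph (Fin n)) (u w x y : Fin n) : SimpleGraph (Fin n) :=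
  (G.deleteEdges {s(u, w), s(x, y)}) ⊔ fromEdgeSet {s(u, x), s(w, y)}

theorem switch_adj {n : ℕ} (G : SimpleGraph (Fin n)) (u w x y a b : Fin n) :
    (switch G u w x y).Adj a b ↔
      (G.Adj a b ∧ s(a, b) ≠ s(u, w) ∧ s(a, b) ≠ s(x, y)) ∨
        ((s(a, b) = s(u, x) ∨ s(a, b) = s(w, y)) ∧ a ≠ b) := by
  simp [switch]

/-- The edges `uw`, `xy` of `G` can be switched. -/
structure Switchable {n : ℕ} (G : SimpleGraph (Fin n)) (u w x y : Fin n) : Prop where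
  uw : G.Adj u w
  xy : G.Adj x y
  xu : x ≠ u
  xw : x ≠ w
  yu : y ≠ u
  yw : y ≠ w
  ux : ¬G.Adj u x
  wy : ¬G.Adj w y

theorem card_replace {α : Type*} [DecidableEq α] {s t : Finset α} {a b : α} (ha : a ∈ s)
    (hb : b ∉ s) (ht : ∀ c, c ∈ t ↔ (c ∈ s ∧ c ≠ a) ∨ c = b) : t.card = s.card := by
  have : t = insert b (s.erase a) := by
    ext c; rw [ht, Finset.mem_insert, Finset.mem_erase]; tauto
  rw [this, Finset.card_insert_of_notMem (fun h => hb (Finset.mem_of_mem_erase h)),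
    Finset.card_erase_add_one ha]

-- Each of the four vertices trades one neighbour for another, and the two assumed non-adjacencies
-- make the traded neighbours new.
open Classical in
theorem Switchable.regular {n d : ℕ} {G : SimpleGraph (Fin n)} {u w x y : Fin n}
    (h : Switchable G u w x y) (hG : G ∈ regularGraphs n d) :
    switch G u w x y ∈ regularGraphs n d := by
  rw [mem_regularGraphs] at hG ⊢
  obtain ⟨h1, h2, h3, h4, h5, h6, h7, h8⟩ := h
  have huw := h1.ne
  have hxy := h2.ne
  intro z
  rw [← hG z, ← card_neighborFinset_eq_degree, ← card_neighborFinset_eq_degree]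
  by_cases hzu : z = u
  · subst hzu
    refine card_replace (a := w) (b := x) (by simpa using h1) (by simpa using h7) fun c => ?_
    simp only [mem_neighborFinset, switch_adj, Sym2.eq_iff]
    grind
  by_cases hzw : z = w
  · subst hzw
    refine card_replace (a := u) (b := y) (by simpa using h1.symm) (by simpa using h8) fun c => ?_
    simp only [mem_neighborFinset, switch_adj, Sym2.eq_iff]
    grind
  by_cases hzx : z = x
  · subst hzx
    refine card_replace (a := y) (b := u) (by simpa using h2)
      (by simpa using fun h => h7 (G.adj_symm h)) fun c => ?_
    simp only [mem_neighborFinset, switch_adj, Sym2.eq_iff]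
    grind
  by_cases hzy : z = y
  · subst hzy
    refine card_replace (a := x) (b := w) (by simpa using h2.symm)
      (by simpa using fun h => h8 (G.adj_symm h)) fun c => ?_
    simp only [mem_neighborFinset, switch_adj, Sym2.eq_iff]
    grind
  congr 1
  ext c
  simp only [mem_neighborFinset, switch_adj, Sym2.eq_iff]
  grind

/-- A switching alters only the pairs `uw`, `xy`, `ux`, `wy`, and switchability prescribes the
status of each of these in the original graph. -/
theorem Switchable.switch_injective {n : ℕ} {G G' : SimpleGraph (Fin n)} {u w x y : Fin n}
    (h : Switchable G u w x y) (h' : Switchable G' u w x y)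
    (heq : switch G u w x y = switch G' u w x y) : G = G' := by
  ext a b
  have := (switch_adj G u w x y a b).symm.trans
    ((iff_of_eq (congrArg (fun H => SimpleGraph.Adj H a b) heq)).trans (switch_adj G' u w x y a b))
  obtain ⟨h1, h2, h3, h4, h5, h6, h7, h8⟩ := h
  obtain ⟨g1, g2, g3, g4, g5, g6, g7, g8⟩ := h'
  have := h1.symm
  have := h2.symm
  have := g1.symm
  have := g2.symm
  have : ¬G.Adj x u := fun h => h7 h.symm
  have : ¬G.Adj y w := fun h => h8 h.symm
  have : ¬G'.Adj x u := fun h => g7 h.symm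
  have : ¬G'.Adj y w := fun h => g8 h.symm
  simp only [Sym2.eq_iff] at *
  grind

open Classical in
theorem card_filter_adj_of_fst_mem {n d : ℕ} {G : SimpleGraph (Fin n)}
    (hG : G ∈ regularGraphs n d) (T : Finset (Fin n)) :
    (univ.filter fun p : Fin n × Fin n => G.Adj p.1 p.2 ∧ p.1 ∈ T).card = T.card * d := by
  rw [mem_regularGraphs] at hG
  rw [Finset.card_eq_sum_card_fiberwise (f := Prod.fst) (t := T) (by intro p hp; simp at hp; simp [hp])]
  rw [← smul_eq_mul, ← Finset.sum_const]
  refine Finset.sum_congr rfl fun a ha => ?_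
  rw [← hG a, ← card_neighborFinset_eq_degree]
  refine Finset.card_bij (fun p _ => p.2) ?_ ?_ ?_
  · rintro ⟨x, y⟩ h
    simp at h ⊢
    rw [← h.2]; exact h.1.1
  · rintro ⟨x, y⟩ h ⟨x', y'⟩ h' heq
    simp at h h' heq
    simp [h.2, h'.2, heq]
  · intro b hb
    simp at hb
    exact ⟨(a, b), by simp [hb, ha], rfl⟩

open Classical in
theorem card_filter_adj_of_snd_mem {n d : ℕ} {G : SimpleGraph (Fin n)}
    (hG : G ∈ regularGraphs n d) (T : Finset (Fin n)) :
    (univ.filter fun p : Fin n × Fin n => G.Adj p.1 p.2 ∧ p.2 ∈ T).card = T.card * d := by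
  rw [← card_filter_adj_of_fst_mem hG T]
  refine Finset.card_bij (fun p _ => p.swap) ?_ ?_ ?_
  · rintro ⟨x, y⟩ h
    simp at h ⊢
    exact ⟨h.1.symm, h.2⟩
  · rintro ⟨x, y⟩ h ⟨x', y'⟩ h' heq
    simpa [and_comm] using heq
  · rintro ⟨x, y⟩ hb
    simp at hb
    exact ⟨(y, x), by simp [hb.1.symm, hb.2], rfl⟩

open Classical in
theorem card_filter_mk_mem_le {n : ℕ} (S : Finset (Sym2 (Fin n))) :
    (univ.filter fun p : Fin n × Fin n => s(p.1, p.2) ∈ S).card ≤ 2 * S.card := by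
  refine Finset.card_le_mul_card_image_of_maps_to (f := fun p : Fin n × Fin n => s(p.1, p.2))
    (fun p hp => (Finset.mem_filter.1 hp).2) 2 fun e _ => ?_
  induction e using Sym2.ind with
  | _ a b =>
    refine (Finset.card_le_card (t := {(a, b), (b, a)}) ?_).trans Finset.card_le_two
    rintro ⟨x, y⟩ h
    simp at h ⊢
    exact h.2

open Classical in
/-- The pairs `(x, y)` for which the switching of `uw`, `xy` keeps the edges in `S`. -/
def switchPairs {n : ℕ} (G : SimpleGraph (Fin n)) (S : Finset (Sym2 (Fin n))) (u w : Fin n) :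
    Finset (Fin n × Fin n) :=
  univ.filter fun p => Switchable G u w p.1 p.2 ∧ s(p.1, p.2) ∉ S

-- Of the `n * d` ordered adjacent pairs, at most `2 * S.card` lie in `S`, and at most `(d + 2) * d`
-- are spoiled by each of the two conditions on `x` (near `u`) and on `y` (near `w`). The hypothesis
-- makes this at most half of all pairs.
open Classical in
theorem le_card_switchPairs {n d : ℕ} {G : SimpleGraph (Fin n)} (hG : G ∈ regularGraphs n d)
    {S : Finset (Sym2 (Fin n))} {u w : Fin n} (huw : G.Adj u w)
    (hn : 4 * S.card + 4 * ((d + 2) * d) ≤ n * d) :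
    n * d ≤ 2 * (switchPairs G S u w).card := by
  have hreg := mem_regularGraphs.1 hG
  set Tu : Finset (Fin n) := insert u (insert w (G.neighborFinset u)) with hTu
  set Tw : Finset (Fin n) := insert u (insert w (G.neighborFinset w)) with hTw
  have hTuc : Tu.card ≤ d + 2 := by
    have h1 : Tu.card ≤ (insert w (G.neighborFinset u)).card + 1 := Finset.card_insert_le _ _
    have h2 : (insert w (G.neighborFinset u)).card ≤ _ := Finset.card_insert_le _ _
    rw [card_neighborFinset_eq_degree, hreg u] at h2
    omega
  have hTwc : Tw.card ≤ d + 2 := by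
    have h1 : Tw.card ≤ (insert w (G.neighborFinset w)).card + 1 := Finset.card_insert_le _ _
    have h2 : (insert w (G.neighborFinset w)).card ≤ _ := Finset.card_insert_le _ _
    rw [card_neighborFinset_eq_degree, hreg w] at h2
    omega
  have htot := card_filter_adj_of_fst_mem hG univ
  have hu := (card_filter_adj_of_fst_mem hG Tu).le.trans (Nat.mul_le_mul_right d hTuc)
  have hw := (card_filter_adj_of_snd_mem hG Tw).le.trans (Nat.mul_le_mul_right d hTwc)
  have hS := card_filter_mk_mem_le S
  rw [Finset.card_univ, Fintype.card_fin] at htot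
  have hsub : (univ.filter fun p : Fin n × Fin n => G.Adj p.1 p.2 ∧ p.1 ∈ univ) ⊆
      switchPairs G S u w ∪ ((univ.filter fun p : Fin n × Fin n => s(p.1, p.2) ∈ S) ∪
        ((univ.filter fun p : Fin n × Fin n => G.Adj p.1 p.2 ∧ p.1 ∈ Tu) ∪
          (univ.filter fun p : Fin n × Fin n => G.Adj p.1 p.2 ∧ p.2 ∈ Tw))) := by
    rintro ⟨x, y⟩ h
    simp only [Finset.mem_union, Finset.mem_filter, Finset.mem_univ, true_and, and_true,
      switchPairs] at h ⊢
    by_cases h1 : s(x, y) ∈ S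
    · exact Or.inr (Or.inl h1)
    by_cases h2 : x ∈ Tu
    · exact Or.inr (Or.inr (Or.inl ⟨h, h2⟩))
    by_cases h3 : y ∈ Tw
    · exact Or.inr (Or.inr (Or.inr ⟨h, h3⟩))
    simp [hTu] at h2
    simp [hTw] at h3
    exact Or.inl ⟨⟨huw, h, h2.1, h2.2.1, h3.1, h3.2.1, h2.2.2, h3.2.2⟩, h1⟩
  have := (Finset.card_le_card hsub).trans ((Finset.card_union_le _ _).trans
    (Nat.add_le_add_left ((Finset.card_union_le _ _).trans
      (Nat.add_le_add_left (Finset.card_union_le _ _) _)) _))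
  rw [htot] at this
  omega

/-- Each pair that is not in `S` is an edge of only a small fraction of the regular graphs that
contain `S`. -/
theorem card_containing_insert_le {n d : ℕ} (hd : 0 < d) {S : Finset (Sym2 (Fin n))} {u w : Fin n}
    (huw : s(u, w) ∉ S) (hn : 4 * S.card + 4 * ((d + 2) * d) ≤ n * d) :
    n * (containing n d (insert s(u, w) S)).card ≤ 2 * d * (containing n d S).card := by
  classical
  set A := containing n d (insert s(u, w) S) with hA
  set B := containing n d S with hB
  have h1 : A.card * (n * d) ≤ 2 * (A.sigma fun G => switchPairs G S u w).card := by
    rw [Finset.card_sigma, Finset.mul_sum, ← smul_eq_mul, ← Finset.sum_const]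
    refine Finset.sum_le_sum fun G hG => ?_
    rw [hA, mem_containing_insert, mem_containing] at hG
    exact le_card_switchPairs hG.1.1 hG.2 hn
  -- Double counting: after the switching `x` is a neighbour of `u` and `y` one of `w`, so each
  -- graph containing `S` is reached in at most `d * d` ways.
  have h2 : (A.sigma fun G => switchPairs G S u w).card ≤
      (B.sigma fun G => G.neighborFinset u ×ˢ G.neighborFinset w).card := by
    refine Finset.card_le_card_of_injOn
      (fun q => ⟨switch q.1 u w q.2.1 q.2.2, (q.2.1, q.2.2)⟩) ?_ ?_
    · rintro ⟨G, x, y⟩ h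
      simp only [Finset.coe_sigma, Set.mem_sigma_iff, Finset.mem_coe, switchPairs,
        Finset.mem_filter, Finset.mem_univ, true_and] at h
      obtain ⟨hGA, hsw, hxyS⟩ := h
      rw [hA, mem_containing_insert, mem_containing] at hGA
      obtain ⟨⟨hG, hGS⟩, hGuw⟩ := hGA
      simp only [Finset.coe_sigma, Set.mem_sigma_iff, Finset.mem_coe, hB, mem_containing,
        Finset.mem_product, mem_neighborFinset, switch_adj]
      refine ⟨⟨hsw.regular hG, fun e he => ?_⟩, Or.inr ⟨by simp, hsw.xu.symm⟩,
        Or.inr ⟨by simp, hsw.yw.symm⟩⟩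
      have heG := hGS e he
      induction e using Sym2.ind with
      | _ a b =>
        rw [mem_edgeSet] at heG ⊢
        rw [switch_adj]
        refine Or.inl ⟨heG, fun h => huw (h ▸ he), fun h => hxyS (h ▸ he)⟩
    · rintro ⟨G, x, y⟩ h ⟨G', x', y'⟩ h' heq
      simp only [Finset.coe_sigma, Set.mem_sigma_iff, Finset.mem_coe, switchPairs,
        Finset.mem_filter, Finset.mem_univ, true_and] at h h'
      simp only [Sigma.mk.injEq, heq_eq_eq, Prod.mk.injEq] at heq
      obtain ⟨hs, rfl, rfl⟩ := heq
      rw [h.2.1.switch_injective h'.2.1 hs]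
  have h3 : (B.sigma fun G => G.neighborFinset u ×ˢ G.neighborFinset w).card = B.card * (d * d) := by
    rw [Finset.card_sigma, ← smul_eq_mul, ← Finset.sum_const]
    refine Finset.sum_congr rfl fun G hG => ?_
    rw [hB, mem_containing] at hG
    have := mem_regularGraphs.1 hG.1
    rw [Finset.card_product, card_neighborFinset_eq_degree, card_neighborFinset_eq_degree,
      this u, this w]
  refine Nat.le_of_mul_le_mul_right (c := d) ?_ hd
  calc n * A.card * d = A.card * (n * d) := by ring
    _ ≤ 2 * (B.card * (d * d)) := by rw [← h3]; exact h1.trans (Nat.mul_le_mul_left 2 h2)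
    _ = 2 * d * B.card * d := by ring

/-! ### Existence of regular graphs -/

open Classical in
/-- The Cayley graph on `Fin n` of a symmetric connection set. -/
theorem regularGraphs_nonempty_of_symmetric {n d : ℕ} [NeZero n] (T : Finset (Fin n))
    (h0 : (0 : Fin n) ∉ T) (hneg : ∀ a ∈ T, -a ∈ T) (hT : T.card = d) :
    (regularGraphs n d).Nonempty := by
  refine ⟨⟨fun a b => b - a ∈ T, ⟨fun a b h => ?_⟩, ⟨fun a h => ?_⟩⟩, mem_regularGraphs.2 fun v => ?_⟩
  · have := hneg _ h
    rwa [neg_sub] at this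
  · rw [sub_self] at h; exact h0 h
  · rw [← hT, ← card_neighborFinset_eq_degree]
    refine Finset.card_bij (fun a _ => a - v) ?_ ?_ ?_
    · intro a ha
      simpa using ha
    · intro a _ b _ h
      exact sub_left_inj.1 h
    · intro b hb
      exact ⟨b + v, by simpa using hb, by simp⟩

-- Needed because a mean over an empty family would be zero by the convention on division. The graph
-- is a circulant one; for odd `d` the number `n` is even, and `n / 2`, its own inverse, supplies
-- the odd element of the connection set.
open Classical in
theorem regularGraphs_nonempty {n d : ℕ} [NeZero n] (hn : d < n) (hnd : Even (n * d)) :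
    (regularGraphs n d).Nonempty := by
  have hval : ∀ a : Fin n, a ≠ 0 → (-a).val = n - a.val := fun a ha => by
    rw [Fin.val_neg, if_neg ha]
  have hv0 : ∀ a : Fin n, a ≠ 0 ↔ a.val ≠ 0 := fun a => by rw [Ne, Fin.ext_iff]; simp
  have key : ∀ U : Finset ℕ, (∀ i ∈ U, 0 < i ∧ i < n ∧ n - i ∈ U) → U.card = d →
      (regularGraphs n d).Nonempty := by
    intro U hU hc
    refine regularGraphs_nonempty_of_symmetric (univ.filter fun a : Fin n => a.val ∈ U) ?_ ?_ ?_
    · intro h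
      have := hU _ (Finset.mem_filter.1 h).2
      simp at this
    · intro a ha
      have h := hU _ (Finset.mem_filter.1 ha).2
      rw [Finset.mem_filter, hval a ((hv0 a).2 h.1.ne')]
      exact ⟨Finset.mem_univ _, h.2.2⟩
    · rw [← hc]
      refine Finset.card_bij (fun a _ => a.val) ?_ ?_ ?_
      · intro a ha; exact (Finset.mem_filter.1 ha).2
      · intro a _ b _ h; exact Fin.ext h
      · intro i hi
        exact ⟨⟨i, (hU i hi).2.1⟩, by simpa using hi, rfl⟩
  rcases Nat.even_or_odd' d with ⟨k, rfl | rfl⟩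
  · refine key (Finset.Icc 1 k ∪ Finset.Icc (n - k) (n - 1)) ?_ ?_
    · intro i hi
      simp only [Finset.mem_union, Finset.mem_Icc] at hi ⊢
      omega
    · rw [Finset.card_union_of_disjoint, Nat.card_Icc, Nat.card_Icc]
      · omega
      · rw [Finset.disjoint_left]
        intro i hi hi'
        simp only [Finset.mem_Icc] at hi hi'
        omega
  · obtain ⟨m, hm⟩ : Even n := by
      rcases Nat.even_mul.1 hnd with h | h
      · exact h
      · exact absurd h (Nat.not_even_bit1 k)
    refine key (insert m (Finset.Icc 1 k ∪ Finset.Icc (n - k) (n - 1))) ?_ ?_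
    · intro i hi
      simp only [Finset.mem_insert, Finset.mem_union, Finset.mem_Icc] at hi ⊢
      omega
    · rw [Finset.card_insert_of_notMem, Finset.card_union_of_disjoint, Nat.card_Icc, Nat.card_Icc]
      · omega
      · rw [Finset.disjoint_left]
        intro i hi hi'
        simp only [Finset.mem_Icc] at hi hi'
        omega
      · simp only [Finset.mem_union, Finset.mem_Icc]
        omega

/-! ### Random neighbours in random regular graphs -/

open Classical in
theorem expect_randNeighbor {n d : ℕ} (hd : 0 < d) {G : SimpleGraph (Fin n)}
    (hG : G ∈ regularGraphs n d) (v : Fin n) (f : Fin n → ℝ≥0∞) :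
    expect (randNeighbor G v) f = (d : ℝ≥0∞)⁻¹ * ∑ w, if G.Adj v w then f w else 0 := by
  have hdeg : (G.neighborFinset v).card = d := by
    rw [card_neighborFinset_eq_degree, mem_regularGraphs.1 hG v]
  have hne : (G.neighborFinset v).Nonempty := Finset.card_pos.1 (hdeg ▸ hd)
  unfold randNeighbor
  rw [dif_pos hne]
  unfold expect
  rw [tsum_fintype, Finset.mul_sum]
  refine Finset.sum_congr rfl fun w _ => ?_
  rw [PMF.uniformOfFinset_apply, hdeg]
  simp only [mem_neighborFinset]
  split_ifs <;> simp

/-- The reply `w` has the same weight `1 / d` in every graph that contains the edge `vw`. So the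
posterior after a probe is again uniform on the graphs containing the revealed edges, and the past
of the algorithm enters only through that set. -/
theorem sum_containing_randNeighbor {n d : ℕ} (hd : 0 < d) (S : Finset (Sym2 (Fin n)))
    (v : Fin n) (f : Fin n → SimpleGraph (Fin n) → ℝ≥0∞) :
    ∑ G ∈ containing n d S, expect (randNeighbor G v) (fun w => f w G) =
      (d : ℝ≥0∞)⁻¹ * ∑ w, ∑ G ∈ containing n d (insert s(v, w) S), f w G := by
  classical
  rw [Finset.sum_congr rfl fun G hG =>
    expect_randNeighbor hd (mem_containing.1 hG).1 v fun w => f w G]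
  rw [← Finset.mul_sum, Finset.sum_comm]
  congr 1
  refine Finset.sum_congr rfl fun w _ => ?_
  rw [← Finset.sum_filter]
  refine Finset.sum_congr ?_ fun _ _ => rfl
  ext G
  rw [mem_containing_insert, Finset.mem_filter]

theorem sum_card_containing_insert {n d : ℕ} (hd : 0 < d) (S : Finset (Sym2 (Fin n)))
    (v : Fin n) :
    (d : ℝ≥0∞)⁻¹ * ∑ w, ((containing n d (insert s(v, w) S)).card : ℝ≥0∞) =
      (containing n d S).card := by
  have := sum_containing_randNeighbor hd S v fun _ _ => 1
  simp only [expect_const, Finset.sum_const, nsmul_eq_mul, mul_one] at this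
  exact this.symm

theorem containing_insert_loop {n d : ℕ} (S : Finset (Sym2 (Fin n))) (v : Fin n) :
    containing n d (insert s(v, v) S) = ∅ := by
  ext G
  rw [mem_containing_insert]
  simp

/-- `S'` arises from `S` by adding edges one by one, each of which leads to a new vertex: one
that is neither in `W` nor incident with an edge added before. -/
inductive Pendant {V : Type*} [DecidableEq V] :
    Finset V → Finset (Sym2 V) → Finset (Sym2 V) → Prop
  | refl (W : Finset V) (S : Finset (Sym2 V)) : Pendant W S S
  | step {W : Finset V} {S S' : Finset (Sym2 V)} {v w : V} (hw : w ∉ W) (hwv : w ≠ v)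
      (h : Pendant (insert v (insert w W)) (insert s(v, w) S) S') : Pendant W S S'

/-- All endpoints of edges in `S` are in `W`. -/
def EndpointsIn {V : Type*} (S : Finset (Sym2 V)) (W : Finset V) : Prop :=
  ∀ e ∈ S, ∀ v ∈ e, v ∈ W

theorem EndpointsIn.insert {V : Type*} [DecidableEq V] {S : Finset (Sym2 V)} {W : Finset V}
    (h : EndpointsIn S W) (v w : V) :
    EndpointsIn (insert s(v, w) S) (insert v (insert w W)) := by
  intro e he x hx
  rcases Finset.mem_insert.1 he with rfl | he
  · rcases Sym2.mem_iff.1 hx with rfl | rfl <;> simp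
  · simp [h e he x hx]

/-- Every pair outside `S` is an edge of at most the fraction `d * ε` of the regular graphs that
contain `S`, as long as `S` has at most `K` elements. -/
def EdgeUnlikely (n d : ℕ) (K : ℕ) (ε : ℝ≥0∞) : Prop :=
  ∀ (S : Finset (Sym2 (Fin n))) (u w : Fin n), S.card ≤ K → s(u, w) ∉ S →
    ((containing n d (insert s(u, w) S)).card : ℝ≥0∞) ≤ d * ε * (containing n d S).card

/-- A union bound over the probes. `β` bounds the failure after any pendant continuation; a probe
whose new edge ends in the current `W` is charged with full failure and costs at most `W.card * ε`.
Each probe enlarges `W` by at most two vertices, whence `W.card + 2 * m`. -/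
theorem sum_run_le {n d K : ℕ} [NeZero n] {α : Type} {ε : ℝ≥0∞} (hd : 0 < d)
    (hε : EdgeUnlikely n d K ε) (β : ℝ≥0∞)
    (f : α → Finset (Sym2 (Fin n)) → SimpleGraph (Fin n) → ℝ≥0∞) (hf : ∀ a S G, f a S G ≤ 1)
    (c : ProbeComp n α) : ∀ (m : ℕ) (S : Finset (Sym2 (Fin n))) (W : Finset (Fin n)),
      c.ProbesAtMost m → EndpointsIn S W → S.card + m ≤ K →
      (∀ a S', Pendant W S S' → S'.card ≤ S.card + m →
        ∑ G ∈ containing n d S', f a S' G ≤ β * (containing n d S').card) →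
      ∑ G ∈ containing n d S, expect (c.run G S) (fun x => f x.1 x.2 G) ≤
        (β + (m * (W.card + 2 * m) : ℕ) * ε) * (containing n d S).card := by
  induction c with
  | ret a =>
    intro m S W _ _ _ h
    simp only [ProbeComp.run, expect_pure]
    refine (h a S (.refl _ _) (by omega)).trans ?_
    gcongr
    exact le_self_add
  | coin p k ih =>
    intro m S W hm hS hK h
    simp only [ProbeComp.run, expect_bind]
    rw [← expect_finset_sum]
    refine (expect_mono _ fun i => ih i m S W (hm i) hS hK h).trans_eq (expect_const _ _)
  | vertexProbe k ih =>
    intro m S W hm hS hK h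
    obtain _ | m := m
    · exact hm.elim
    simp only [ProbeComp.run, expect_bind]
    rw [← expect_finset_sum]
    refine (expect_mono _ fun i => ih i m S W (hm i) hS (by omega)
      fun a S' h1 h2 => h a S' h1 (by omega)).trans ((expect_const _ _).trans_le ?_)
    gcongr <;> omega
  | neighborProbe v k ih =>
    intro m S W hm hS hK h
    obtain _ | m := m
    · exact hm.elim
    simp only [ProbeComp.run, expect_bind]
    rw [sum_containing_randNeighbor hd]
    have hbound : ∀ w, ∑ G ∈ containing n d (insert s(v, w) S),
        expect ((k w).run G (insert s(v, w) S)) (fun x => f x.1 x.2 G) ≤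
        (β + (m * (W.card + 2 + 2 * m) : ℕ) * ε) * (containing n d (insert s(v, w) S)).card +
          if w ∈ W then d * ε * (containing n d S).card else 0 := by
      intro w
      by_cases hin : s(v, w) ∈ S
      · rw [Finset.insert_eq_of_mem hin]
        refine (ih w m S W (hm w) hS (by omega)
          fun a S' h1 h2 => h a S' h1 (by omega)).trans (le_add_right ?_)
        gcongr
        omega
      have hcard := Finset.card_insert_of_notMem hin
      by_cases hwW : w ∈ W
      · rw [if_pos hwW]
        refine le_add_left (le_trans ?_ (hε S v w (by omega) hin))
        refine (Finset.sum_le_sum fun G _ => expect_le_one _ fun x => hf _ _ _).trans ?_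
        simp
      by_cases hwv : w = v
      · rw [hwv, containing_insert_loop]
        simp
      · have hWc : (insert v (insert w W)).card ≤ W.card + 2 :=
          (Finset.card_insert_le _ _).trans (by have := Finset.card_insert_le w W; omega)
        refine (ih w m _ (insert v (insert w W)) (hm w) (hS.insert v w) (by omega)
          fun a S' h1 h2 => h a S' (.step hwW hwv h1) (by omega)).trans (le_add_right ?_)
        gcongr
    refine (mul_le_mul_right (Finset.sum_le_sum fun w _ => hbound w) _).trans ?_
    rw [Finset.sum_add_distrib, ← Finset.mul_sum, mul_add, mul_left_comm,
      sum_card_containing_insert hd, ← Finset.sum_filter, Finset.sum_const, nsmul_eq_mul]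
    have hd0 : (d : ℝ≥0∞) ≠ 0 := by exact_mod_cast hd.ne'
    have hfil : (univ.filter fun w => w ∈ W) = W := by ext; simp
    rw [hfil]
    -- The weight `1 / d` of a reply cancels the factor `d` in `EdgeUnlikely`.
    calc _ = (β + (m * (W.card + 2 + 2 * m) : ℕ) * ε) * (containing n d S).card +
          ((d : ℝ≥0∞)⁻¹ * d) * (W.card * ε * (containing n d S).card) := by ring
      _ = (β + (m * (W.card + 2 + 2 * m) + W.card : ℕ) * ε) * (containing n d S).card := by
          rw [ENNReal.inv_mul_cancel hd0 (ENNReal.natCast_ne_top d)]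
          push_cast
          ring
      _ ≤ _ := by
          gcongr
          nlinarith

/-! ### Forests grown by pendant edges -/

section Forest

variable {V : Type*}

/-- The graph with the edges in `S`. -/
def edgeGraph (S : Finset (Sym2 V)) : SimpleGraph V := fromEdgeSet (S : Set (Sym2 V))

theorem edgeGraph_adj {S : Finset (Sym2 V)} {a b : V} :
    (edgeGraph S).Adj a b ↔ s(a, b) ∈ S ∧ a ≠ b := by
  simp [edgeGraph]

/-- All walks in `F` from `o` to `v` pass through `b`. -/
def Separates (F : SimpleGraph V) (o b v : V) : Prop := ∀ p : F.Walk o v, b ∈ p.support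

theorem edgeGraph_insert [DecidableEq V] (S : Finset (Sym2 V)) (v w : V) :
    edgeGraph (insert s(v, w) S) = edgeGraph S ⊔ edge v w := by
  ext a b
  rw [sup_adj, edgeGraph_adj, edgeGraph_adj, edge_adj, Finset.mem_insert, Sym2.eq_iff]
  tauto

theorem Pendant.subset [DecidableEq V] {W : Finset V} {S S' : Finset (Sym2 V)}
    (h : Pendant W S S') : S ⊆ S' := by
  induction h with
  | refl => exact Finset.Subset.refl _
  | step _ _ _ ih => exact (Finset.subset_insert _ _).trans ih

theorem EndpointsIn.not_adj {S : Finset (Sym2 V)} {W : Finset V} (h : EndpointsIn S W) {a w : V}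
    (hw : w ∉ W) : ¬(edgeGraph S).Adj w a :=
  fun hadj => hw (h _ (edgeGraph_adj.1 hadj).1 w (Sym2.mem_mk_left _ _))

theorem EndpointsIn.not_reachable {S : Finset (Sym2 V)} {W : Finset V} (h : EndpointsIn S W)
    {v w : V} (hw : w ∉ W) (hwv : w ≠ v) : ¬(edgeGraph S).Reachable v w := by
  rintro ⟨p⟩
  cases hp : p.reverse with
  | nil => exact hwv rfl
  | cons hadj _ => exact h.not_adj hw hadj

theorem Pendant.isAcyclic [DecidableEq V] {W : Finset V} {S S' : Finset (Sym2 V)}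
    (h : Pendant W S S') (hS : EndpointsIn S W) (hac : (edgeGraph S).IsAcyclic) :
    (edgeGraph S').IsAcyclic := by
  induction h with
  | refl => exact hac
  | @step W S S' v w hw hwv _ ih =>
    refine ih (hS.insert v w) ?_
    rw [edgeGraph_insert]
    exact hac.sup_edge_of_not_reachable (hS.not_reachable hw hwv)

/-- When a pendant vertex is attached it has a single neighbour, so a path between two older
vertices cannot run through it. Hence pendant edges create no new connections inside `W`. -/
theorem Pendant.edges_mem [DecidableEq V] {W : Finset V} {S S' : Finset (Sym2 V)}
    (h : Pendant W S S') (hS : EndpointsIn S W) {a b : V} (ha : a ∈ W) (hb : b ∈ W)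
    (p : (edgeGraph S').Walk a b) (hp : p.IsPath) : ∀ e ∈ p.edges, e ∈ (edgeGraph S).edgeSet := by
  induction h with
  | refl => exact fun e he => p.edges_subset_edgeSet he
  | @step W S S' v w hw hwv _ ih =>
    have h1 := ih (hS.insert v w) (by simp [ha]) (by simp [hb]) p hp
    have hp' : (p.transfer _ h1).IsPath := hp.transfer h1
    have hnot : w ∉ (p.transfer _ h1).support := by
      refine hp'.isTrail.not_mem_support_of_subsingleton_neighborSet
        (fun h => hw (h ▸ ha)) (fun h => hw (h ▸ hb)) ?_
      intro x hx y hy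
      have key : ∀ z, (edgeGraph (insert s(v, w) S)).Adj w z → z = v := by
        intro z hz
        rw [edgeGraph_insert, sup_adj, edge_adj] at hz
        rcases hz with hz | hz
        · exact absurd hz (hS.not_adj hw)
        · rcases hz.1 with h | h
          · exact absurd h.1 hwv
          · exact h.2
      rw [key x hx, key y hy]
    intro e he
    have h2 := h1 e he
    rw [edgeGraph_insert, edgeSet_sup] at h2
    rcases h2 with h2 | h2
    · exact h2
    · have := edgeSet_edge_subset h2
      have : e = s(v, w) := by simpa using this
      subst this
      rw [Walk.support_transfer] at hnot
      exact absurd (p.snd_mem_support_of_mem_edges he) hnot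

theorem Pendant.le [DecidableEq V] {W : Finset V} {S S' : Finset (Sym2 V)}
    (h : Pendant W S S') : edgeGraph S ≤ edgeGraph S' :=
  fromEdgeSet_mono (Finset.coe_subset.2 h.subset)

theorem Pendant.separates_iff [DecidableEq V] {W : Finset V} {S S' : Finset (Sym2 V)}
    (h : Pendant W S S') (hS : EndpointsIn S W) {o b v : V} (ho : o ∈ W) (hv : v ∈ W) :
    Separates (edgeGraph S') o b v ↔ Separates (edgeGraph S) o b v := by
  constructor
  · intro hs p
    have := hs (p.mapLe h.le)
    simpa using this
  · intro hs p
    have hp := p.bypass_isPath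
    have := hs (p.bypass.transfer _ (h.edges_mem hS ho hv p.bypass hp))
    rw [Walk.support_transfer] at this
    exact p.support_bypass_subset_support this

theorem Pendant.dist_eq [DecidableEq V] {W : Finset V} {S S' : Finset (Sym2 V)}
    (h : Pendant W S S') (hS : EndpointsIn S W) {o v : V} (ho : o ∈ W) (hv : v ∈ W) :
    (edgeGraph S').dist o v = (edgeGraph S).dist o v := by
  by_cases hr : (edgeGraph S').Reachable o v
  · obtain ⟨p, hp, hl⟩ := hr.exists_path_of_dist
    have hE := h.edges_mem hS ho hv p hp
    have h1 : (edgeGraph S).dist o v ≤ (edgeGraph S').dist o v := by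
      rw [← hl, ← p.length_transfer hE]
      exact dist_le _
    refine le_antisymm ?_ h1
    obtain ⟨q, _, hq⟩ := (p.transfer _ hE).reachable.exists_path_of_dist
    rw [← hq, ← Walk.length_mapLe h.le]
    exact dist_le _
  · rw [dist_eq_zero_of_not_reachable hr,
      dist_eq_zero_of_not_reachable fun h' => hr (h'.mono h.le)]

/-! ### Walks in forests -/

theorem exists_walk_of_adj {F : SimpleGraph V} (f : ℕ → V) {z t : ℕ} (hzt : z ≤ t)
    (h : ∀ i, z ≤ i → i < t → F.Adj (f i) (f (i + 1))) :
    ∃ q : F.Walk (f z) (f t), q.length = t - z ∧ (∀ x ∈ q.support, ∃ i, z ≤ i ∧ i ≤ t ∧ x = f i) ∧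
      ∀ e ∈ q.edges, ∃ i, z ≤ i ∧ i < t ∧ e = s(f i, f (i + 1)) := by
  induction t, hzt using Nat.le_induction with
  | base => exact ⟨.nil, by simp, fun x hx => ⟨z, le_rfl, le_rfl, by simpa using hx⟩, by simp⟩
  | succ t hzt ih =>
    obtain ⟨q, h1, h2, h3⟩ := ih fun i hi hi' => h i hi (by omega)
    refine ⟨q.concat (h t hzt (by omega)), ?_, ?_, ?_⟩
    · rw [Walk.length_concat]; omega
    · intro x hx
      rw [Walk.support_concat] at hx
      simp only [List.mem_append, List.mem_singleton] at hx
      rcases hx with hx | rfl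
      · obtain ⟨i, hi, hi', rfl⟩ := h2 x hx
        exact ⟨i, hi, by omega, rfl⟩
      · exact ⟨t + 1, by omega, le_rfl, rfl⟩
    · intro e he
      rw [Walk.edges_concat] at he
      simp only [List.concat_eq_append, List.mem_append, List.mem_singleton] at he
      rcases he with he | rfl
      · obtain ⟨i, hi, hi', rfl⟩ := h3 e he
        exact ⟨i, hi, by omega, rfl⟩
      · exact ⟨t, hzt, by omega, rfl⟩

theorem le_add_length_of_lipschitz {F : SimpleGraph V} (g : V → ℕ) {a b : V} (q : F.Walk a b)
    (h : ∀ x y, s(x, y) ∈ q.edges → g y ≤ g x + 1) : g b ≤ g a + q.length := by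
  induction q with
  | nil => simp
  | @cons a c b hadj q ih =>
    have h1 := ih fun x y hxy => h x y (by simp [hxy])
    have h2 := h a c (by simp)
    rw [Walk.length_cons]
    omega

theorem isAcyclic_length_eq_dist {F : SimpleGraph V} (hF : F.IsAcyclic) {a b : V}
    (p : F.Walk a b) (hp : p.IsPath) : p.length = F.dist a b := by
  obtain ⟨q, hq, hl⟩ := p.reachable.exists_path_of_dist
  have := (hF.subsingleton_path a b).elim ⟨p, hp⟩ ⟨q, hq⟩
  rw [← hl, Subtype.mk.inj this]

theorem dist_le_card {S : Finset (Sym2 V)} (a b : V) : (edgeGraph S).dist a b ≤ S.card := by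
  classical
  by_cases hr : (edgeGraph S).Reachable a b
  · obtain ⟨p, hp, hl⟩ := hr.exists_path_of_dist
    rw [← hl, ← p.length_edges, ← List.toFinset_card_of_nodup hp.isTrail.edges_nodup]
    refine Finset.card_le_card fun e he => ?_
    have := p.edges_subset_edgeSet (List.mem_toFinset.1 he)
    simp [edgeGraph] at this
    exact this.1
  · rw [dist_eq_zero_of_not_reachable hr]
    exact Nat.zero_le _

theorem IsPath.append_of_inter {F : SimpleGraph V} {a b c : V} {p : F.Walk a b} {q : F.Walk b c}
    (hp : p.IsPath) (hq : q.IsPath) (h : ∀ x ∈ p.support, x ∈ q.support → x = b) :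
    (p.append q).IsPath := by
  rw [Walk.isPath_def, Walk.support_append, List.nodup_append']
  have hq' := hq.support_nodup
  rw [← Walk.cons_tail_support, List.nodup_cons] at hq'
  refine ⟨hp.support_nodup, hq'.2, fun x hx hx' => ?_⟩
  rw [h x hx (List.mem_of_mem_tail hx')] at hx'
  exact hq'.1 hx'

/-- A walk that escapes linearly (as measured by a Lipschitz function `g`), but does so only
slowly in its distance from `o`, must move towards `o` first. -/
theorem exists_separates_of_slow {F : SimpleGraph V} (hF : F.IsAcyclic) (o : V) (f : ℕ → V)
    {s r R : ℕ} (hR : R = 23 * r)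
    (hadj : ∀ i, s ≤ i → i < s + R → F.Adj (f i) (f (i + 1)))
    (g : V → ℕ) (hg : ∀ i, s ≤ i → i < s + R →
      g (f (i + 1)) ≤ g (f i) + 1 ∧ g (f i) ≤ g (f (i + 1)) + 1)
    (hslope : ∀ i j, s ≤ i → i + r ≤ j → j ≤ s + R → 10 * g (f i) + (j - i) ≤ 10 * g (f j))
    (hslow : 20 * F.dist o (f (s + R)) ≤ 20 * F.dist o (f s) + R) :
    ∃ y, s + r ≤ y ∧ y ≤ s + R ∧ Separates F o (f y) (f s) := by
  classical
  by_contra! hcon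
  by_cases hreach : F.Reachable o (f s)
  swap
  -- If the origin does not reach `f s`, every vertex separates the two vacuously.
  · exact hcon (s + r) le_rfl (by omega) fun p => absurd p.reachable hreach
  obtain ⟨π, hπ, hπl⟩ := hreach.exists_path_of_dist
  have havoid : ∀ y, s + r ≤ y → y ≤ s + R → f y ∉ π.support := by
    intro y h1 h2 hmem
    refine hcon y h1 h2 fun p => ?_
    have := (hF.subsingleton_path _ _).elim ⟨π, hπ⟩ ⟨p.bypass, p.bypass_isPath⟩
    rw [Subtype.mk.inj this] at hmem
    exact p.support_bypass_subset_support hmem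
  -- The last time `z` in the window at which the walk is on the path `π` from the origin. It is
  -- before `s + r`, and from `f z` on the walk branches off `π` for good.
  set Z := (Finset.Icc s (s + R)).filter fun z => f z ∈ π.support with hZ
  have hne : Z.Nonempty := ⟨s, by simp [hZ]⟩
  obtain ⟨hzZ, hzmax⟩ := And.intro (Z.max'_mem hne) (fun i hi => Z.le_max' i hi)
  set z := Z.max' hne
  rw [hZ, Finset.mem_filter, Finset.mem_Icc] at hzZ
  obtain ⟨⟨hsz, hzt⟩, hzπ⟩ := hzZ
  have hzr : z < s + r := by
    by_contra hzr
    exact havoid z (by omega) hzt hzπ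
  obtain ⟨q, hql, hqs, hqe⟩ := exists_walk_of_adj f hzt
    (F := F) fun i hi hi' => hadj i (by omega) hi'
  obtain ⟨q', hq'l, -, -⟩ := exists_walk_of_adj f hsz
    (F := F) fun i hi hi' => hadj i (by omega) (by omega)
  have hpath : ((π.takeUntil _ hzπ).append q.bypass).IsPath := by
    refine IsPath.append_of_inter (hπ.takeUntil hzπ) q.bypass_isPath fun x hx hx' => ?_
    obtain ⟨i, hi, hi', rfl⟩ := hqs x (q.support_bypass_subset_support hx')
    have := hzmax i (by
      rw [hZ, Finset.mem_filter, Finset.mem_Icc]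
      exact ⟨⟨by omega, hi'⟩, π.support_takeUntil_subset_support hzπ hx⟩)
    rw [le_antisymm this hi]
  have hlen := isAcyclic_length_eq_dist hF _ hpath
  rw [Walk.length_append] at hlen
  have hds := dist_le ((π.takeUntil _ hzπ).append q'.reverse)
  rw [Walk.length_append, Walk.length_reverse] at hds
  have hlip := le_add_length_of_lipschitz g q.bypass fun x y hxy => by
    obtain ⟨i, hi, hi', he⟩ := hqe _ (q.edges_bypass_subset_edges hxy)
    have := hg i (by omega) hi'
    rcases Sym2.eq_iff.1 he with ⟨rfl, rfl⟩ | ⟨rfl, rfl⟩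
    · exact this.1
    · exact this.2
  have hsl := hslope z (s + R) hsz (by omega) le_rfl
  -- With `a` the length of `π` up to `f z`: the start of the window is at distance at most `a + (z
  -- - s)`, and its end at distance at least `a + (s + R - z) / 10`. As `z - s < r`, twenty times
  -- the gain exceeds `2 * R - 22 * r`, which is at least `R` because `R = 23 * r`; this contradicts
  -- slowness.
  omega

end Forest

/-! ### Adaptive searches as decision trees -/

/-- A decision tree that asks for values in `V` at natural numbers. -/
inductive QueryTree (V : Type) : Type
  | done : QueryTree V
  | ask (i : ℕ) (k : V → QueryTree V) : QueryTree V

namespace QueryTree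

variable {V : Type}

/-- The tree asks at most the given number of questions along each branch. -/
def DepthLE : QueryTree V → ℕ → Prop
  | .done, _ => True
  | .ask _ _, 0 => False
  | .ask _ k, m + 1 => ∀ v, (k v).DepthLE m

/-- Follow the tree with the partial information `p` up to the first question whose answer is
not known: the number of questions passed, and the open question. -/
def scan (p : ℕ → Option V) : QueryTree V → ℕ × Option ℕ
  | .done => (0, none)
  | .ask i k =>
      match p i with
      | none => (0, some i)
      | some v => ((scan p (k v)).1 + 1, (scan p (k v)).2)

theorem scan_ask_none {p : ℕ → Option V} {i : ℕ} (k : V → QueryTree V) (h : p i = none) :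
    scan p (.ask i k) = (0, some i) := by
  rw [scan, h]

theorem scan_ask_some {p : ℕ → Option V} {i : ℕ} (k : V → QueryTree V) {v : V}
    (h : p i = some v) :
    scan p (.ask i k) = ((scan p (k v)).1 + 1, (scan p (k v)).2) := by
  rw [scan, h]

theorem scan_ask_finished {p : ℕ → Option V} {i : ℕ} {k : V → QueryTree V}
    (h : (scan p (.ask i k)).2 = none) : ∃ v, p i = some v ∧ (scan p (k v)).2 = none := by
  cases hp : p i with
  | none => rw [scan_ask_none k hp] at h; cases h
  | some v => rw [scan_ask_some k hp] at h; exact ⟨v, rfl, h⟩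

theorem scan_snd_eq_none (p : ℕ → Option V) {T : QueryTree V} :
    ∀ {m : ℕ}, T.DepthLE m → m ≤ (scan p T).1 → (scan p T).2 = none := by
  induction T with
  | done => exact fun _ _ => rfl
  | ask i k ih =>
    rintro (_ | m) h hm
    · exact h.elim
    · cases hp : p i with
      | none => rw [scan_ask_none k hp] at hm; exact absurd hm (by simp)
      | some v =>
        rw [scan_ask_some k hp] at hm ⊢
        exact ih v (h v) (Nat.le_of_succ_le_succ hm)

theorem eq_none_of_scan {p : ℕ → Option V} {T : QueryTree V} {i : ℕ}
    (h : (scan p T).2 = some i) : p i = none := by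
  induction T with
  | done => cases h
  | ask j k ih =>
    cases hp : p j with
    | none =>
      rw [scan_ask_none k hp] at h
      cases h
      exact hp
    | some v =>
      rw [scan_ask_some k hp] at h
      exact ih v h

/-- The number of questions passed serves as the measure of progress: answering the open question
moves the scan at least one step down the same tree. -/
theorem scan_fst_lt {p p' : ℕ → Option V} (hpp : ∀ j v, p j = some v → p' j = some v)
    {T : QueryTree V} {i : ℕ} (h : (scan p T).2 = some i) {v : V} (hv : p' i = some v) :
    (scan p T).1 + 1 ≤ (scan p' T).1 := by
  induction T with
  | done => cases h
  | ask j k ih =>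
    cases hp : p j with
    | none =>
      rw [scan_ask_none k hp] at h ⊢
      cases h
      rw [scan_ask_some k hv]
      simp
    | some w =>
      rw [scan_ask_some k hp] at h ⊢
      rw [scan_ask_some k (hpp _ _ hp)]
      exact Nat.succ_le_succ (ih w h)

/-- Halve the interval from `s` to `s + R * 2 ^ k` repeatedly, keeping a half on which `h` grows
slowly. -/
def slopeSearch (h : V → ℕ) (R : ℕ) (cont : ℕ → QueryTree V) : ℕ → ℕ → QueryTree V
  | 0, s => cont s
  | k + 1, s => .ask s fun a => .ask (s + R * 2 ^ k) fun b =>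
      if 20 * h b ≤ 20 * h a + R * 2 ^ k then slopeSearch h R cont k s
      else slopeSearch h R cont k (s + R * 2 ^ k)

/-- Ask for the values at `s, …, s + l - 1`, recording them in `f`. -/
def askRange (s : ℕ) (cont : (ℕ → V) → QueryTree V) : ℕ → (ℕ → V) → QueryTree V
  | 0, f => cont f
  | l + 1, f => .ask (s + l) fun v => askRange s cont l (Function.update f (s + l) v)

open Classical in
/-- Bisection for a place where `P` becomes true. -/
def bisect (P : V → Prop) : ℕ → ℕ → ℕ → QueryTree V
  -- The end points are asked although the bisection does not branch on them: both positions of the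
  -- critical step must be among the answers.
  | 0, x, y => .ask x fun _ => .ask y fun _ => .done
  | j + 1, x, y => .ask ((x + y) / 2) fun v =>
      if P v then bisect P j x ((x + y) / 2) else bisect P j ((x + y) / 2) y

open Classical in
/-- Continue with some number that satisfies `Y`, if there is one. -/
def pick (Y : ℕ → Prop) (cont : ℕ → QueryTree V) : QueryTree V :=
  if hy : ∃ y, Y y then cont hy.choose else .done

/-- The search for a contradiction in a purported walk: find a window in which the walk is slow,
look at all of it, and search for an earlier visit to a vertex of the window that separates the
start of the window from the origin. -/
def search (h : V → ℕ) (sep : V → V → Prop) (r R k j : ℕ) (v₀ : V) : QueryTree V :=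
  slopeSearch h R (fun s => askRange s (fun f =>
    pick (fun y => s + r ≤ y ∧ y ≤ s + R ∧ sep (f y) (f s)) fun y =>
      bisect (sep (f y)) j 0 s) (R + 1) fun _ => v₀) k 0

theorem depthLE_slopeSearch {h : V → ℕ} {R D : ℕ} {cont : ℕ → QueryTree V}
    (hc : ∀ s, (cont s).DepthLE D) : ∀ k s, (slopeSearch h R cont k s).DepthLE (2 * k + D)
  | 0, s => by simpa [slopeSearch] using hc s
  | k + 1, s => by
    rw [show 2 * (k + 1) + D = 2 * k + D + 1 + 1 by ring]
    intro a b
    dsimp only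
    split_ifs
    · exact depthLE_slopeSearch hc k s
    · exact depthLE_slopeSearch hc k _

theorem depthLE_askRange {s D : ℕ} {cont : (ℕ → V) → QueryTree V}
    (hc : ∀ f, (cont f).DepthLE D) : ∀ l f, (askRange s cont l f).DepthLE (l + D)
  | 0, f => by simpa [askRange] using hc f
  | l + 1, f => by
    rw [show l + 1 + D = l + D + 1 by ring]
    intro v
    exact depthLE_askRange hc l _

theorem depthLE_bisect (P : V → Prop) : ∀ j x y, (bisect P j x y).DepthLE (j + 2)
  | 0, x, y => fun _ _ => trivial
  | j + 1, x, y => by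
    intro v
    dsimp only
    split_ifs
    · exact depthLE_bisect P j _ _
    · exact depthLE_bisect P j _ _

theorem depthLE_search (h : V → ℕ) (sep : V → V → Prop) (r R k j : ℕ) (v₀ : V) :
    (search h sep r R k j v₀).DepthLE (2 * k + (R + 1 + (j + 2))) := by
  refine depthLE_slopeSearch (fun s => depthLE_askRange (fun f => ?_) _ _) _ _
  unfold pick
  split_ifs
  · exact depthLE_bisect _ _ _ _
  · trivial

theorem scan_ask_congr {p : ℕ → Option V} {i : ℕ} {c c' : V → QueryTree V}
    (h : ∀ v, p i = some v → scan p (c v) = scan p (c' v)) :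
    scan p (.ask i c) = scan p (.ask i c') := by
  cases hp : p i with
  | none => rw [scan_ask_none c hp, scan_ask_none c' hp]
  | some v => rw [scan_ask_some c hp, scan_ask_some c' hp, h v hp]

theorem scan_slopeSearch_congr {p : ℕ → Option V} {h h' : V → ℕ} {R : ℕ}
    {cont cont' : ℕ → QueryTree V} (hh : ∀ i v, p i = some v → h v = h' v)
    (hc : ∀ s, scan p (cont s) = scan p (cont' s)) :
    ∀ k s, scan p (slopeSearch h R cont k s) = scan p (slopeSearch h' R cont' k s)
  | 0, s => hc s
  | k + 1, s => by
    refine scan_ask_congr fun a ha => scan_ask_congr fun b hb => ?_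
    rw [hh _ _ ha, hh _ _ hb]
    split_ifs
    · exact scan_slopeSearch_congr hh hc k _
    · exact scan_slopeSearch_congr hh hc k _

theorem scan_askRange_congr {p : ℕ → Option V} {s : ℕ} {cont cont' : (ℕ → V) → QueryTree V}
    {L : ℕ} (hc : ∀ f : ℕ → V, (∀ i, s ≤ i → i < s + L → p i = some (f i)) →
      scan p (cont f) = scan p (cont' f)) : ∀ l f, l ≤ L →
      (∀ i, s + l ≤ i → i < s + L → p i = some (f i)) →
      scan p (askRange s cont l f) = scan p (askRange s cont' l f)
  | 0, f, _, hf => hc f hf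
  | l + 1, f, hl, hf => by
    refine scan_ask_congr fun v hv => scan_askRange_congr hc l _ (by omega) fun i hi hi' => ?_
    by_cases h : i = s + l
    · subst h; simpa using hv
    · rw [Function.update_of_ne h]
      exact hf i (by omega) hi'

theorem scan_bisect_congr {p : ℕ → Option V} {P P' : V → Prop}
    (hP : ∀ i v, p i = some v → (P v ↔ P' v)) :
    ∀ j x y, scan p (bisect P j x y) = scan p (bisect P' j x y)
  | 0, x, y => rfl
  | j + 1, x, y => by
    refine scan_ask_congr fun v hv => ?_
    by_cases h : P v
    · rw [if_pos h, if_pos ((hP _ _ hv).1 h)]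
      exact scan_bisect_congr hP j _ _
    · rw [if_neg h, if_neg fun h' => h ((hP _ _ hv).2 h')]
      exact scan_bisect_congr hP j _ _

/-- The search depends only on the relations between known vertices. -/
theorem scan_search_congr {p : ℕ → Option V} {h h' : V → ℕ} {sep sep' : V → V → Prop}
    (hh : ∀ i v, p i = some v → h v = h' v)
    (hs : ∀ i a i' b, p i = some a → p i' = some b → (sep a b ↔ sep' a b)) (r R k j : ℕ) (v₀ : V) :
    scan p (search h sep r R k j v₀) = scan p (search h' sep' r R k j v₀) := by
  refine scan_slopeSearch_congr hh (fun s => scan_askRange_congr (L := R + 1) (fun f hf => ?_) _ _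
    le_rfl fun i hi hi' => by omega) _ _
  -- `pick` uses choice, so the two predicates must be equal for the chosen times to agree. They
  -- are, since the whole window is known at this point.
  have hY : (fun y => s + r ≤ y ∧ y ≤ s + R ∧ sep (f y) (f s)) =
      fun y => s + r ≤ y ∧ y ≤ s + R ∧ sep' (f y) (f s) := by
    funext y
    refine propext (and_congr_right fun h1 => and_congr_right fun h2 => ?_)
    exact hs y _ s _ (hf y (by omega) (by omega)) (hf s (by omega) (by omega))
  rw [hY]
  unfold pick
  split_ifs with hy
  · have hspec := hy.choose_spec
    exact scan_bisect_congr (fun i v hv =>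
      hs _ _ _ _ (hf _ (by omega) (by omega)) hv) _ _ _
  · rfl

/-- Pigeonhole: if the interval is slow and its first half is not, then the second half is. The
slope allowed is the same at all scales. -/
theorem slopeSearch_finished {p : ℕ → Option V} {σ : ℕ → V} (hpσ : ∀ i v, p i = some v → v = σ i)
    {h : V → ℕ} {R : ℕ} {cont : ℕ → QueryTree V} : ∀ k s,
      (scan p (slopeSearch h R cont k s)).2 = none →
      20 * h (σ (s + R * 2 ^ k)) ≤ 20 * h (σ s) + R * 2 ^ k →
      ∃ s', s' + R ≤ s + R * 2 ^ k ∧ 20 * h (σ (s' + R)) ≤ 20 * h (σ s') + R ∧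
        (scan p (cont s')).2 = none
  | 0, s, hfin, hle => ⟨s, by simp, by simpa using hle, hfin⟩
  | k + 1, s, hfin, hle => by
    obtain ⟨a, ha, hfin⟩ := scan_ask_finished hfin
    obtain ⟨b, hb, hfin⟩ := scan_ask_finished hfin
    obtain rfl := hpσ _ _ ha
    obtain rfl := hpσ _ _ hb
    have hpow : R * 2 ^ (k + 1) = R * 2 ^ k + R * 2 ^ k := by ring
    rw [hpow] at hle ⊢
    split_ifs at hfin with hcond
    · obtain ⟨s', h1, h2, h3⟩ := slopeSearch_finished hpσ k s hfin hcond
      exact ⟨s', by omega, h2, h3⟩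
    · obtain ⟨s', h1, h2, h3⟩ := slopeSearch_finished hpσ k (s + R * 2 ^ k) hfin (by
        rw [add_assoc]; omega)
      exact ⟨s', by omega, h2, h3⟩

theorem askRange_finished {p : ℕ → Option V} {s : ℕ} {cont : (ℕ → V) → QueryTree V} {L : ℕ} :
    ∀ l f, l ≤ L → (∀ i, s + l ≤ i → i < s + L → p i = some (f i)) →
      (scan p (askRange s cont l f)).2 = none →
      ∃ f' : ℕ → V, (∀ i, s ≤ i → i < s + L → p i = some (f' i)) ∧ (scan p (cont f')).2 = none
  | 0, f, _, hf, hfin => ⟨f, hf, hfin⟩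
  | l + 1, f, hl, hf, hfin => by
    obtain ⟨v, hv, hfin⟩ := scan_ask_finished hfin
    refine askRange_finished l _ (by omega) (fun i hi hi' => ?_) hfin
    by_cases h : i = s + l
    · subst h; simpa using hv
    · rw [Function.update_of_ne h]
      exact hf i (by omega) hi'

theorem bisect_finished {p : ℕ → Option V} {σ : ℕ → V} (hpσ : ∀ i v, p i = some v → v = σ i)
    {P : V → Prop} : ∀ j x y, (scan p (bisect P j x y)).2 = none → x ≤ y → y - x ≤ 2 ^ j →
      ¬P (σ x) → P (σ y) →
      ∃ z, x ≤ z ∧ z < y ∧ p z = some (σ z) ∧ p (z + 1) = some (σ (z + 1)) ∧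
        ¬P (σ z) ∧ P (σ (z + 1))
  | 0, x, y, hfin, hxy, hlen, hx, hy => by
    obtain ⟨a, ha, hfin⟩ := scan_ask_finished hfin
    obtain ⟨b, hb, hfin⟩ := scan_ask_finished hfin
    obtain rfl := hpσ _ _ ha
    obtain rfl := hpσ _ _ hb
    have hne : x ≠ y := fun h => hx (h ▸ hy)
    obtain rfl : y = x + 1 := by simp at hlen; omega
    exact ⟨x, le_rfl, by omega, ha, hb, hx, hy⟩
  | j + 1, x, y, hfin, hxy, hlen, hx, hy => by
    obtain ⟨a, ha, hfin⟩ := scan_ask_finished hfin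
    obtain rfl := hpσ _ _ ha
    rw [pow_succ] at hlen
    split_ifs at hfin with hcond
    · obtain ⟨z, h1, h2, h3⟩ := bisect_finished hpσ j _ _ hfin (by omega) (by omega) hx hcond
      exact ⟨z, h1, by omega, h3⟩
    · obtain ⟨z, h1, h2, h3⟩ := bisect_finished hpσ j _ _ hfin (by omega) (by omega) hcond hy
      exact ⟨z, by omega, h2, h3⟩

/-- A finished search in a forest with few edges meets two consecutive positions of the walk that
are not adjacent in the forest, if the walk escapes linearly. -/
theorem search_finished {S : Finset (Sym2 V)} (hS : (edgeGraph S).IsAcyclic) {p : ℕ → Option V}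
    {σ : ℕ → V} (hpσ : ∀ i v, p i = some v → v = σ i) {r R k j : ℕ} (hR : R = 23 * r)
    (hr : 0 < r) (hcard : 20 * S.card ≤ R * 2 ^ k) (hj : R * 2 ^ k ≤ 2 ^ j)
    (g : V → ℕ) (hg : ∀ i, i < R * 2 ^ k →
      g (σ (i + 1)) ≤ g (σ i) + 1 ∧ g (σ i) ≤ g (σ (i + 1)) + 1)
    (hslope : ∀ i l, i + r ≤ l → l ≤ R * 2 ^ k → 10 * g (σ i) + (l - i) ≤ 10 * g (σ l)) {v₀ : V}
    (hfin : (scan p (search (fun v => (edgeGraph S).dist (σ 0) v)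
      (fun b v => Separates (edgeGraph S) (σ 0) b v) r R k j v₀)).2 = none) :
    ∃ i, i < R * 2 ^ k ∧ p i = some (σ i) ∧ p (i + 1) = some (σ (i + 1)) ∧
      ¬(edgeGraph S).Adj (σ i) (σ (i + 1)) := by
  by_contra! hadj
  have hreturn : ∀ i l, i + r ≤ l → l ≤ R * 2 ^ k → σ i ≠ σ l := by
    intro i l h1 h2 h
    have := hslope i l h1 h2
    rw [h] at this
    omega
  -- The whole interval is slow because a distance in the forest is at most its number of edges; the
  -- value zero of `dist` for unreachable vertices also counts as slow.
  obtain ⟨s, hsL, hslow, hfin⟩ := slopeSearch_finished hpσ k 0 hfin (by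
    have := dist_le_card (S := S) (σ 0) (σ (0 + R * 2 ^ k))
    simp only [SimpleGraph.dist_self]
    omega)
  rw [zero_add] at hsL
  obtain ⟨f, hf, hfin⟩ := askRange_finished (L := R + 1) _ _ le_rfl
    (fun i hi hi' => by omega) hfin
  have hfσ : ∀ i, s ≤ i → i < s + (R + 1) → f i = σ i := fun i hi hi' => hpσ _ _ (hf i hi hi')
  have hknown : ∀ i, s ≤ i → i < s + (R + 1) → p i = some (σ i) := fun i hi hi' => by
    rw [← hfσ i hi hi', hf i hi hi']
  have hex : ∃ y, s + r ≤ y ∧ y ≤ s + R ∧ Separates (edgeGraph S) (σ 0) (f y) (f s) := by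
    obtain ⟨y, h1, h2, h3⟩ := exists_separates_of_slow hS (σ 0) σ hR
      (fun i hi hi' => hadj i (by omega) (hknown i hi (by omega))
        (hknown (i + 1) (by omega) (by omega))) g
      (fun i _ hi' => hg i (by omega)) (fun i l _ h1 h2 => hslope i l h1 (by omega)) hslow
    exact ⟨y, h1, h2, by rwa [hfσ y (by omega) (by omega), hfσ s le_rfl (by omega)]⟩
  rw [pick, dif_pos hex] at hfin
  obtain ⟨h1, h2, h3⟩ := hex.choose_spec
  set y := hex.choose
  rw [hfσ y (by omega) (by omega)] at hfin h3
  rw [hfσ s le_rfl (by omega)] at h3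
  obtain ⟨z, -, hzs, hz, hz', hnP, hP⟩ := bisect_finished hpσ j 0 s hfin (by omega) (by omega)
    (fun hsep => by
      have := hsep .nil
      rw [Walk.support_nil, List.mem_singleton] at this
      exact hreturn 0 y (by omega) (by omega) this.symm) h3
  -- Take a walk from the origin to `σ z` that avoids `σ y` and extend it by the revealed edge to `σ
  -- (z + 1)`. It has to meet `σ y`, so `σ (z + 1) = σ y`; this return is excluded by escape, as `z
  -- + 1 ≤ s` and `s + r ≤ y`.
  unfold Separates at hnP
  push Not at hnP
  obtain ⟨q, hq⟩ := hnP
  have := hP (q.concat (hadj z (by omega) hz hz'))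
  rw [Walk.support_concat] at this
  simp only [List.mem_append, List.mem_singleton] at this
  rcases this with h | h
  · exact hq h
  · exact hreturn (z + 1) y (by omega) (by omega) h.symm

end QueryTree

/-! ### The reduced walk -/

section Stack

variable {V : Type*} [DecidableEq V]

/-- Extend a reduced walk, written with its last vertex first, by a vertex `w`: step back if `w`
is the vertex before the last one. -/
def push : List V → V → List V
  | a :: b :: l, w => if w = b then b :: l else w :: a :: b :: l
  | l, w => w :: l

/-- The reduction of the walk `f 0, …, f t`, the last vertex first. -/
def stack (f : ℕ → V) : ℕ → List V
  | 0 => [f 0]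
  | t + 1 => push (stack f t) (f (t + 1))

theorem stack_congr {f f' : ℕ → V} : ∀ {t : ℕ}, (∀ i ≤ t, f i = f' i) → stack f t = stack f' t
  | 0, h => by rw [stack, stack, h 0 le_rfl]
  | t + 1, h => by
    rw [stack, stack, stack_congr fun i hi => h i (by omega), h _ le_rfl]

/-- Each of the first `L` steps of `f` goes along an edge used before or to a new vertex. -/
def PendantWalk (f : ℕ → V) (L : ℕ) : Prop :=
  ∀ i < L, (∃ j < i, s(f i, f (i + 1)) = s(f j, f (j + 1))) ∨ ∀ j ≤ i, f (i + 1) ≠ f j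

theorem push_cons_of_ne {a w : V} {l : List V} (h : ∀ b l', l = b :: l' → w ≠ b) :
    push (a :: l) w = w :: a :: l := by
  cases l with
  | nil => rfl
  | cons b l' => rw [push, if_neg (h b l' rfl)]

/-- The reduction of a pendant walk is determined by the last vertex. -/
theorem exists_ancestors (f : ℕ → V) (L : ℕ) (h : PendantWalk f L) :
    ∃ A : V → List V, (∀ i ≤ L, stack f i = A (f i)) ∧
      (∀ i < L, A (f (i + 1)) = f (i + 1) :: A (f i) ∨ A (f i) = f i :: A (f (i + 1))) ∧
      ∀ i ≤ L, ∃ l, A (f i) = f i :: l ∧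
        ∀ b l', l = b :: l' → A b = b :: l' ∧ ∃ j ≤ L, f j = b := by
  induction L with
  | zero =>
    refine ⟨fun _ => [f 0], ?_, by simp, ?_⟩
    · intro i hi
      rw [Nat.le_zero.1 hi, stack]
    · intro i hi
      rw [Nat.le_zero.1 hi]
      exact ⟨[], rfl, by simp⟩
  | succ L ih =>
    obtain ⟨A, h1, h2, h3⟩ := ih fun i hi => h i (by omega)
    obtain ⟨l, hl, hl'⟩ := h3 L le_rfl
    have hstack : stack f (L + 1) = push (f L :: l) (f (L + 1)) := by
      rw [stack, h1 L le_rfl, hl]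
    rcases h L (by omega) with ⟨j, hj, hedge⟩ | hfresh
    -- `A` lists the ancestors of a vertex in the traced tree. An edge used before joins a parent
    -- and a child, so the step is a pop or a push, and `A` needs no change.
    · have hrel : A (f (L + 1)) = f (L + 1) :: A (f L) ∨ A (f L) = f L :: A (f (L + 1)) := by
        rcases Sym2.eq_iff.1 hedge with ⟨h4, h5⟩ | ⟨h4, h5⟩
        · rw [h4, h5]; exact h2 j hj
        · rw [h4, h5]; exact (h2 j hj).symm
      have hmem : ∃ i ≤ L, f (L + 1) = f i := by
        rcases Sym2.eq_iff.1 hedge with ⟨h4, h5⟩ | ⟨h4, h5⟩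
        · exact ⟨j + 1, hj, h5⟩
        · exact ⟨j, hj.le, h5⟩
      obtain ⟨i₀, hi₀, hfi₀⟩ := hmem
      refine ⟨A, ?_, ?_, ?_⟩
      · intro i hi
        rcases Nat.lt_or_ge i (L + 1) with hi' | hi'
        · exact h1 i (by omega)
        obtain rfl : i = L + 1 := by omega
        rw [hstack]
        rcases hrel with hrel | hrel
        · rw [push_cons_of_ne, ← hl, hrel]
          rintro b l' rfl hb
          have h4 := (hl' b l' rfl).1
          rw [← hb, hrel, hl] at h4
          have := congrArg List.length h4
          simp at this
          omega
        · obtain ⟨l₁, hl₁, -⟩ := h3 i₀ hi₀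
          rw [← hfi₀] at hl₁
          rw [hl, hl₁] at hrel
          obtain rfl := (List.cons.inj hrel).2
          rw [push, if_pos rfl, hl₁]
      · intro i hi
        rcases Nat.lt_or_ge i L with hi' | hi'
        · exact h2 i hi'
        obtain rfl : i = L := by omega
        exact hrel
      · intro i hi
        rcases Nat.lt_or_ge i (L + 1) with hi' | hi'
        · obtain ⟨l, h4, h5⟩ := h3 i (by omega)
          exact ⟨l, h4, fun b l' hb => ⟨(h5 b l' hb).1, (h5 b l' hb).2.imp
            fun j hj => ⟨hj.1.trans (Nat.le_succ L), hj.2⟩⟩⟩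
        obtain rfl : i = L + 1 := by omega
        obtain ⟨l, h4, h5⟩ := h3 i₀ hi₀
        rw [← hfi₀] at h4
        exact ⟨l, h4, fun b l' hb => ⟨(h5 b l' hb).1, (h5 b l' hb).2.imp
            fun j hj => ⟨hj.1.trans (Nat.le_succ L), hj.2⟩⟩⟩
    -- A new vertex becomes a child of the current one. It differs from the second entry of the
    -- stack because that entry was visited, which is why the induction carries the last clause.
    · have hA : ∀ i ≤ L, Function.update A (f (L + 1)) (f (L + 1) :: A (f L)) (f i) = A (f i) :=
        fun i hi => Function.update_of_ne (hfresh i hi).symm _ _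
      refine ⟨Function.update A (f (L + 1)) (f (L + 1) :: A (f L)), ?_, ?_, ?_⟩
      · intro i hi
        rcases Nat.lt_or_ge i (L + 1) with hi' | hi'
        · rw [hA i (by omega)]
          exact h1 i (by omega)
        obtain rfl : i = L + 1 := by omega
        rw [hstack, Function.update_self, push_cons_of_ne, hl]
        intro b l' hb
        obtain ⟨j, hj, rfl⟩ := (hl' b l' hb).2
        exact hfresh j hj
      · intro i hi
        rcases Nat.lt_or_ge i L with hi' | hi'
        · rw [hA i (by omega), hA (i + 1) hi']
          exact h2 i hi'
        obtain rfl : i = L := by omega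
        rw [hA i le_rfl, Function.update_self]
        exact Or.inl rfl
      · intro i hi
        rcases Nat.lt_or_ge i (L + 1) with hi' | hi'
        · obtain ⟨l, h4, h5⟩ := h3 i (by omega)
          refine ⟨l, by rw [hA i (by omega), h4], fun b l' hb => ?_⟩
          obtain ⟨h6, j, hj, rfl⟩ := h5 b l' hb
          exact ⟨by rw [hA j hj, h6], j, by omega, rfl⟩
        obtain rfl : i = L + 1 := by omega
        refine ⟨A (f L), Function.update_self _ _ _, fun b l' hb => ?_⟩
        rw [hl] at hb
        obtain ⟨rfl, rfl⟩ := List.cons.inj hb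
        exact ⟨by rw [hA L le_rfl, hl], L, by omega, rfl⟩

end Stack

/-! ### Events of the random walk -/

/-- The position at time `i` of a sequence of length `l`, which is extended by its last entry. -/
def extend {V : Type*} {l : ℕ} (σ : Fin (l + 1) → V) (i : ℕ) : V :=
  σ ⟨min i l, Nat.lt_succ_of_le (Nat.min_le_right i l)⟩

theorem extend_snoc_of_le {V : Type} {l : ℕ} (σ : Fin (l + 1) → V) (w : V) {i : ℕ} (hi : i ≤ l) :
    extend (l := l + 1) (Fin.snoc (α := fun _ => V) σ w) i = extend σ i := by
  have h : (⟨min i (l + 1), Nat.lt_succ_of_le (Nat.min_le_right i (l + 1))⟩ : Fin (l + 1 + 1)) =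
      Fin.castSucc ⟨min i l, Nat.lt_succ_of_le (Nat.min_le_right i l)⟩ := by
    ext
    simp only [Fin.val_castSucc]
    omega
  rw [extend, extend, h, Fin.snoc_castSucc]

theorem extend_snoc_last {V : Type} {l : ℕ} (σ : Fin (l + 1) → V) (w : V) :
    extend (l := l + 1) (Fin.snoc (α := fun _ => V) σ w) (l + 1) = w := by
  have h : (⟨min (l + 1) (l + 1), Nat.lt_succ_of_le (Nat.min_le_right _ (l + 1))⟩ :
      Fin (l + 1 + 1)) = Fin.last (l + 1) := by
    ext
    simp
  rw [extend, h, Fin.snoc_last]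

theorem expect_walk_succ {n : ℕ} [NeZero n] (G : SimpleGraph (Fin n)) (l : ℕ)
    (Φ : (Fin (l + 1 + 1) → Fin n) → ℝ≥0∞) :
    expect (walk G (l + 1)) Φ = expect (walk G l) fun σ =>
      expect (randNeighbor G (extend σ l)) fun w => Φ (Fin.snoc (α := fun _ => Fin n) σ w) := by
  rw [walk, expect_bind]
  congr 1
  funext σ
  rw [expect_map]
  congr 2
  rw [extend]
  congr 1
  ext
  simp

/-- Events that depend only on the first `L` steps have the same probability for all longer
walks. -/
theorem expect_walk_prefix {n : ℕ} [NeZero n] (G : SimpleGraph (Fin n)) {L l : ℕ} (hL : L ≤ l)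
    (Φ : (ℕ → Fin n) → ℝ≥0∞) (hΦ : ∀ f f' : ℕ → Fin n, (∀ i ≤ L, f i = f' i) → Φ f = Φ f') :
    expect (walk G l) (fun σ => Φ (extend σ)) = expect (walk G L) fun σ => Φ (extend σ) := by
  induction l, hL using Nat.le_induction with
  | base => rfl
  | succ l hL ih =>
    rw [expect_walk_succ, ← ih]
    congr 1
    funext σ
    rw [← expect_const (randNeighbor G (extend σ l)) (Φ (extend σ))]
    congr 1
    funext w
    exact hΦ _ _ fun i hi => extend_snoc_of_le σ w (hi.trans hL)

theorem adj_of_mem_support {n d : ℕ} (hd : 0 < d) {G : SimpleGraph (Fin n)}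
    (hG : G ∈ regularGraphs n d) {v w : Fin n} (hw : w ∈ (randNeighbor G v).support) :
    G.Adj v w := by
  classical
  by_contra hadj
  have h1 := expect_randNeighbor hd hG v fun x => if x = w then 1 else 0
  rw [Finset.sum_eq_zero, mul_zero] at h1
  · unfold expect at h1
    rw [ENNReal.tsum_eq_zero] at h1
    have := h1 w
    simp only [if_true, mul_one] at this
    exact (PMF.mem_support_iff _ _).1 hw this
  · intro x _
    split_ifs with h2 h3
    · exact absurd (h3 ▸ h2) hadj
    · rfl
    · rfl

theorem walk_support {n d : ℕ} [NeZero n] (hd : 0 < d) {G : SimpleGraph (Fin n)}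
    (hG : G ∈ regularGraphs n d) : ∀ (l : ℕ), ∀ σ ∈ (walk G l).support,
      extend σ 0 = 0 ∧ ∀ i < l, G.Adj (extend σ i) (extend σ (i + 1))
  | 0, σ, hσ => by
    rw [walk, PMF.mem_support_pure_iff] at hσ
    subst hσ
    exact ⟨rfl, by simp⟩
  | l + 1, σ, hσ => by
    rw [walk, PMF.mem_support_bind_iff] at hσ
    obtain ⟨σ₀, h0, hσ⟩ := hσ
    rw [PMF.support_map] at hσ
    obtain ⟨w, hw, rfl⟩ := hσ
    obtain ⟨h1, h2⟩ := walk_support hd hG l σ₀ h0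
    refine ⟨by rw [extend_snoc_of_le _ _ (Nat.zero_le _), h1], fun i hi => ?_⟩
    rcases Nat.lt_or_ge i l with hi' | hi'
    · rw [extend_snoc_of_le _ _ hi'.le, extend_snoc_of_le _ _ hi']
      exact h2 i hi'
    obtain rfl : i = l := by omega
    rw [extend_snoc_of_le _ _ le_rfl, extend_snoc_last]
    have : extend σ₀ i = σ₀ (Fin.last i) := by
      rw [extend]; congr 1; ext; simp
    rw [this]
    exact adj_of_mem_support hd hG hw

/-- The set of edges used by the first `l` steps of `f`. -/
def trace {V : Type*} [DecidableEq V] (f : ℕ → V) (l : ℕ) : Finset (Sym2 V) :=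
  (Finset.range l).image fun i => s(f i, f (i + 1))

theorem trace_succ {V : Type*} [DecidableEq V] (f : ℕ → V) (l : ℕ) :
    trace f (l + 1) = insert s(f l, f (l + 1)) (trace f l) := by
  rw [trace, Finset.range_add_one, Finset.image_insert, trace]

theorem trace_congr {V : Type*} [DecidableEq V] {f f' : ℕ → V} {l : ℕ}
    (h : ∀ i ≤ l, f i = f' i) : trace f l = trace f' l := by
  refine Finset.image_congr fun i hi => ?_
  have := Finset.mem_range.1 hi
  rw [h i (by omega), h (i + 1) (by omega)]

theorem card_trace_le {V : Type*} [DecidableEq V] (f : ℕ → V) (l : ℕ) : (trace f l).card ≤ l :=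
  Finset.card_image_le.trans_eq (Finset.card_range l)

/-- The counterpart for the walk of the averaging over probes: given the walk so far, the graph is
uniform among those containing its trace. -/
theorem sum_walk_le {n d : ℕ} [NeZero n] (hd : 0 < d) (c : ℝ≥0∞) : ∀ (l : ℕ)
    (Φ : (Fin (l + 1) → Fin n) → SimpleGraph (Fin n) → ℝ≥0∞),
    (∀ σ, ∑ G ∈ containing n d (trace (extend σ) l), Φ σ G ≤
      c * (containing n d (trace (extend σ) l)).card) →
    ∑ G ∈ regularGraphs n d, expect (walk G l) (fun σ => Φ σ G) ≤
      c * (regularGraphs n d).card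
  | 0, Φ, h => by
    have := h fun _ => 0
    simp only [trace, Finset.range_zero, Finset.image_empty, containing_empty] at this
    simpa only [walk, expect_pure] using this
  | l + 1, Φ, h => by
    simp only [expect_walk_succ]
    refine sum_walk_le hd c l (fun σ G => expect (randNeighbor G (extend σ l)) fun w =>
      Φ (Fin.snoc (α := fun _ => Fin n) σ w) G) fun σ => ?_
    rw [sum_containing_randNeighbor hd, ← sum_card_containing_insert hd _ (extend σ l),
      mul_left_comm]
    refine mul_le_mul_right ?_ _
    rw [Finset.mul_sum]
    refine Finset.sum_le_sum fun w _ => ?_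
    have := h (Fin.snoc (α := fun _ => Fin n) σ w)
    rwa [trace_succ, extend_snoc_last, extend_snoc_of_le _ _ le_rfl,
      trace_congr fun i hi => extend_snoc_of_le σ w hi] at this

theorem PendantWalk.congr {V : Type*} {f f' : ℕ → V} {L : ℕ}
    (hf : ∀ i ≤ L, f i = f' i) (h : PendantWalk f L) : PendantWalk f' L := by
  intro i hi
  rw [← hf i hi.le, ← hf (i + 1) hi]
  rcases h i hi with ⟨j, hj, he⟩ | h'
  · exact Or.inl ⟨j, hj, by rw [he, hf j (by omega), hf (j + 1) (by omega)]⟩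
  · refine Or.inr fun j hj => ?_
    rw [← hf j (by omega)]
    exact h' j hj

/-- Step `l + 1` fails only if a new edge leads to one of at most `l + 1` visited vertices, which
has probability at most `(l + 1) * ε`; these add up to less than the square of the number of steps.
-/
theorem sum_not_pendantWalk_le {n d K : ℕ} [NeZero n] {ε : ℝ≥0∞} (hd : 0 < d)
    (hε : EdgeUnlikely n d K ε) : ∀ l ≤ K,
    ∑ G ∈ regularGraphs n d, expect (walk G l) (fun σ => ind (¬PendantWalk (extend σ) l)) ≤
      (l * l : ℕ) * ε * (regularGraphs n d).card
  | 0, _ => by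
    have : ∀ f : ℕ → Fin n, ind (¬PendantWalk f 0) = 0 := fun f => ind_of_not (by simp [PendantWalk])
    simp [this, expect]
  | l + 1, hl => by
    have hstep : ∀ (σ : Fin (l + 1) → Fin n) (w : Fin n),
        ind (¬PendantWalk (extend (l := l + 1) (Fin.snoc (α := fun _ => Fin n) σ w)) (l + 1)) ≤
        ind (¬PendantWalk (extend σ) l) + ind (s(extend σ l, w) ∉ trace (extend σ) l ∧
          w ∈ (Finset.range (l + 1)).image (extend σ)) := by
      intro σ w
      refine (ind_mono fun h => ?_).trans (ind_or_le _ _)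
      by_contra! hcon
      obtain ⟨h1, h2⟩ := hcon
      refine h fun i hi => ?_
      rcases Nat.lt_or_ge i l with hi' | hi'
      · exact h1.congr (fun i hi => (extend_snoc_of_le σ w hi).symm) i hi'
      obtain rfl : i = l := by omega
      rw [extend_snoc_last, extend_snoc_of_le _ _ le_rfl]
      by_cases h3 : s(extend σ i, w) ∈ trace (extend σ) i
      · obtain ⟨j, hj, he⟩ := Finset.mem_image.1 h3
        have hj := Finset.mem_range.1 hj
        refine Or.inl ⟨j, hj, ?_⟩
        rw [extend_snoc_of_le _ _ hj.le, extend_snoc_of_le _ _ hj, he]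
      · refine Or.inr fun j hj hw => h2 h3 ?_
        rw [extend_snoc_of_le _ _ hj] at hw
        exact Finset.mem_image.2 ⟨j, Finset.mem_range.2 (by omega), hw.symm⟩
    simp only [expect_walk_succ]
    have hle : ∀ G : SimpleGraph (Fin n), expect (walk G l) (fun σ =>
        expect (randNeighbor G (extend σ l)) fun w =>
          ind (¬PendantWalk (extend (l := l + 1) (Fin.snoc (α := fun _ => Fin n) σ w)) (l + 1))) ≤
        expect (walk G l) (fun σ => ind (¬PendantWalk (extend σ) l)) +
          expect (walk G l) (fun σ => expect (randNeighbor G (extend σ l)) fun w =>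
            ind (s(extend σ l, w) ∉ trace (extend σ) l ∧
              w ∈ (Finset.range (l + 1)).image (extend σ))) := by
      intro G
      rw [← expect_add]
      refine expect_mono _ fun σ => (expect_mono _ fun w => hstep σ w).trans_eq ?_
      rw [expect_add, expect_const]
    refine (Finset.sum_le_sum fun G _ => hle G).trans ?_
    rw [Finset.sum_add_distrib]
    have h2 := sum_walk_le (n := n) hd ((l + 1 : ℕ) * ε) l
      (fun σ G => expect (randNeighbor G (extend σ l)) fun w =>
            ind (s(extend σ l, w) ∉ trace (extend σ) l ∧
              w ∈ (Finset.range (l + 1)).image (extend σ))) fun σ => ?_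
    · refine (add_le_add (sum_not_pendantWalk_le hd hε l (by omega)) h2).trans ?_
      rw [← add_mul, ← add_mul, ← Nat.cast_add]
      gcongr
      nlinarith
    · rw [sum_containing_randNeighbor hd]
      have hd0 : (d : ℝ≥0∞) ≠ 0 := by exact_mod_cast hd.ne'
      calc _ ≤ (d : ℝ≥0∞)⁻¹ * ∑ w, (if w ∈ (Finset.range (l + 1)).image (extend σ) then
            d * ε * ((containing n d (trace (extend σ) l)).card : ℝ≥0∞) else 0) := by
            refine mul_le_mul_right (Finset.sum_le_sum fun w _ => ?_) _
            rw [Finset.sum_const, nsmul_eq_mul]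
            split_ifs with hw
            · by_cases hin : s(extend σ l, w) ∈ trace (extend σ) l
              · rw [ind_of_not fun h => h.1 hin, mul_zero]
                exact zero_le
              · refine le_trans ?_ (hε _ _ _ ((card_trace_le _ _).trans (by omega)) hin)
                exact mul_le_of_le_one_right' (ind_le_one _)
            · rw [ind_of_not fun h => hw h.2, mul_zero]
        _ = ((d : ℝ≥0∞)⁻¹ * d) * (((Finset.range (l + 1)).image (extend σ)).card * ε *
              (containing n d (trace (extend σ) l)).card) := by
            rw [← Finset.sum_filter, Finset.sum_const, nsmul_eq_mul]
            have hfil : (univ.filter fun w => w ∈ (Finset.range (l + 1)).image (extend σ)) =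
              (Finset.range (l + 1)).image (extend σ) := by ext; simp
            rw [hfil]
            ring
        _ ≤ _ := by
            rw [ENNReal.inv_mul_cancel hd0 (ENNReal.natCast_ne_top d), one_mul]
            gcongr
            exact Finset.card_image_le.trans_eq (Finset.card_range _)

/-! ### Linear escape of the random walk -/

theorem expect_randNeighbor_eq_le {n d : ℕ} (hd : 3 ≤ d) {G : SimpleGraph (Fin n)}
    (hG : G ∈ regularGraphs n d) (v b : Fin n) :
    expect (randNeighbor G v) (fun w => ind (w = b)) ≤ ((1 / 3 : ℝ≥0) : ℝ≥0∞) := by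
  classical
  rw [expect_randNeighbor (by omega) hG]
  have h1 : (∑ w, if G.Adj v w then ind (w = b) else 0) ≤ 1 := by
    refine (Finset.sum_le_sum (g := fun w => if w = b then (1 : ℝ≥0∞) else 0) fun w _ => ?_).trans ?_
    · by_cases h : w = b
      · simp only [if_pos h]
        split_ifs
        · exact ind_le_one _
        · exact zero_le
      · simp [ind_of_not h, if_neg h]
    · simp
  have h2 : (d : ℝ≥0∞)⁻¹ ≤ ((1 / 3 : ℝ≥0) : ℝ≥0∞) := by
    rw [one_div, ENNReal.coe_inv (by norm_num), ENNReal.inv_le_inv]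
    exact_mod_cast hd
  calc _ ≤ (d : ℝ≥0∞)⁻¹ * 1 := by gcongr
    _ ≤ _ := by rwa [mul_one]

/-- The exponential moment of the height contracts: with a step back of probability at most `1 / 3`,
the factor is at most `(2 / 3) * (3 / 4) + (1 / 3) * (4 / 3) = 17 / 18`. No tree structure of the
graph is involved. -/
theorem expect_push_le {n d : ℕ} (hd : 3 ≤ d) {G : SimpleGraph (Fin n)}
    (hG : G ∈ regularGraphs n d) (v : Fin n) (st : List (Fin n)) :
    expect (randNeighbor G v) (fun w => ((3 / 4 : ℝ≥0) : ℝ≥0∞) ^ (push st w).length) ≤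
      ((17 / 18 : ℝ≥0) : ℝ≥0∞) * ((3 / 4 : ℝ≥0) : ℝ≥0∞) ^ st.length := by
  have hshort : ((3 / 4 : ℝ≥0) : ℝ≥0∞) ≤ ((17 / 18 : ℝ≥0) : ℝ≥0∞) := by
    rw [ENNReal.coe_le_coe, ← NNReal.coe_le_coe]
    push_cast
    norm_num
  rcases st with _ | ⟨a, _ | ⟨b, l⟩⟩
  · simp only [push, List.length_cons, List.length_nil, expect_const]
    simpa using hshort
  · simp only [push, List.length_cons, List.length_nil, expect_const]
    rw [pow_succ']
    gcongr
  -- Every step is counted as a push, and the excess of a pop, with `7 / 16 = 1 - (3 / 4) ^ 2`, is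
  -- added on the event `w = b`; thus only an upper bound on its probability is used.
  · have hpt : ∀ w, ((3 / 4 : ℝ≥0) : ℝ≥0∞) ^ (push (a :: b :: l) w).length ≤
        ((3 / 4 : ℝ≥0) : ℝ≥0∞) ^ (l.length + 3) +
          (((7 / 16 : ℝ≥0) : ℝ≥0∞) * ((3 / 4 : ℝ≥0) : ℝ≥0∞) ^ (l.length + 1)) * ind (w = b) := by
      intro w
      by_cases h : w = b
      · rw [ind_of h, push, if_pos h, List.length_cons]
        refine le_of_eq ?_
        have : ((3 / 4 : ℝ≥0) : ℝ≥0∞) ^ 2 + ((7 / 16 : ℝ≥0) : ℝ≥0∞) = 1 := by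
          rw [← ENNReal.coe_pow, ← ENNReal.coe_add, ENNReal.coe_eq_one, ← NNReal.coe_inj]
          push_cast
          norm_num
        calc _ = (((3 / 4 : ℝ≥0) : ℝ≥0∞) ^ 2 + ((7 / 16 : ℝ≥0) : ℝ≥0∞)) *
              ((3 / 4 : ℝ≥0) : ℝ≥0∞) ^ (l.length + 1) := by rw [this, one_mul]
          _ = _ := by ring
      · rw [ind_of_not h, push, if_neg h]
        simp
    refine (expect_mono _ hpt).trans ?_
    rw [expect_add, expect_const, expect_mul_left]
    have hrat : ((3 / 4 : ℝ≥0) : ℝ≥0∞) ^ 2 + ((7 / 16 : ℝ≥0) : ℝ≥0∞) * ((1 / 3 : ℝ≥0) : ℝ≥0∞) =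
        ((17 / 18 : ℝ≥0) : ℝ≥0∞) * ((3 / 4 : ℝ≥0) : ℝ≥0∞) := by
      rw [← ENNReal.coe_pow, ← ENNReal.coe_mul, ← ENNReal.coe_mul, ← ENNReal.coe_add,
        ENNReal.coe_inj, ← NNReal.coe_inj]
      push_cast
      norm_num
    calc _ ≤ ((3 / 4 : ℝ≥0) : ℝ≥0∞) ^ (l.length + 3) +
          (((7 / 16 : ℝ≥0) : ℝ≥0∞) * ((3 / 4 : ℝ≥0) : ℝ≥0∞) ^ (l.length + 1)) *
            ((1 / 3 : ℝ≥0) : ℝ≥0∞) := by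
          gcongr
          exact expect_randNeighbor_eq_le hd hG v b
      _ = (((3 / 4 : ℝ≥0) : ℝ≥0∞) ^ 2 + ((7 / 16 : ℝ≥0) : ℝ≥0∞) * ((1 / 3 : ℝ≥0) : ℝ≥0∞)) *
            ((3 / 4 : ℝ≥0) : ℝ≥0∞) ^ (l.length + 1) := by ring
      _ = _ := by
          rw [hrat, List.length_cons, List.length_cons]
          ring

theorem expect_stack_le {n d : ℕ} [NeZero n] (hd : 3 ≤ d) {G : SimpleGraph (Fin n)}
    (hG : G ∈ regularGraphs n d) (i k : ℕ) :
    expect (walk G (i + k)) (fun σ =>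
      ((4 / 3 : ℝ≥0) : ℝ≥0∞) ^ (stack (extend σ) i).length *
        ((3 / 4 : ℝ≥0) : ℝ≥0∞) ^ (stack (extend σ) (i + k)).length) ≤
      ((17 / 18 : ℝ≥0) : ℝ≥0∞) ^ k := by
  induction k with
  | zero =>
    have h1 : ((4 / 3 : ℝ≥0) : ℝ≥0∞) * ((3 / 4 : ℝ≥0) : ℝ≥0∞) = 1 := by
      rw [← ENNReal.coe_mul, ENNReal.coe_eq_one, ← NNReal.coe_inj]
      push_cast
      norm_num
    refine (expect_le_one _ fun σ => ?_).trans (by simp)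
    change _ * _ ^ (stack (extend σ) i).length ≤ _
    rw [← mul_pow, h1, one_pow]
  | succ k ih =>
    rw [← add_assoc, expect_walk_succ, pow_succ']
    refine le_trans ?_ (mul_le_mul_right ih _)
    rw [← expect_mul_left]
    refine expect_mono _ fun σ => ?_
    have : ∀ w : Fin n, ((4 / 3 : ℝ≥0) : ℝ≥0∞) ^ (stack (extend (l := i + k + 1)
        (Fin.snoc (α := fun _ => Fin n) σ w)) i).length *
        ((3 / 4 : ℝ≥0) : ℝ≥0∞) ^ (stack (extend (l := i + k + 1)
          (Fin.snoc (α := fun _ => Fin n) σ w)) (i + k + 1)).length =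
        ((4 / 3 : ℝ≥0) : ℝ≥0∞) ^ (stack (extend σ) i).length *
          ((3 / 4 : ℝ≥0) : ℝ≥0∞) ^ (push (stack (extend σ) (i + k)) w).length := by
      intro w
      rw [stack, extend_snoc_last,
        stack_congr (t := i) fun j hj => extend_snoc_of_le σ w (hj.trans (Nat.le_add_right i k)),
        stack_congr (t := i + k) fun j hj => extend_snoc_of_le σ w hj]
    simp only [this]
    rw [expect_mul_left, mul_left_comm]
    exact mul_le_mul_right (expect_push_le hd hG _ _) _

/-- Markov's inequality for the exponential moment; the rate works because `(4 / 3) * (17 / 18) ^ 10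
≤ 4 / 5`. -/
theorem expect_stack_slow_le {n d : ℕ} [NeZero n] (hd : 3 ≤ d) {G : SimpleGraph (Fin n)}
    (hG : G ∈ regularGraphs n d) {i k q : ℕ} (hq : 10 * q ≤ k) :
    expect (walk G (i + k)) (fun σ =>
      ind ((stack (extend σ) (i + k)).length ≤ (stack (extend σ) i).length + q)) ≤
      ((4 / 5 : ℝ≥0) : ℝ≥0∞) ^ q := by
  have h1 : ((4 / 3 : ℝ≥0) : ℝ≥0∞) * ((3 / 4 : ℝ≥0) : ℝ≥0∞) = 1 := by
    rw [← ENNReal.coe_mul, ENNReal.coe_eq_one, ← NNReal.coe_inj]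
    push_cast
    norm_num
  have h2 : ((4 / 3 : ℝ≥0) : ℝ≥0∞) * ((17 / 18 : ℝ≥0) : ℝ≥0∞) ^ 10 ≤
      ((4 / 5 : ℝ≥0) : ℝ≥0∞) := by
    rw [← ENNReal.coe_pow, ← ENNReal.coe_mul, ENNReal.coe_le_coe, ← NNReal.coe_le_coe]
    push_cast
    norm_num
  have h3 : ((3 / 4 : ℝ≥0) : ℝ≥0∞) ≤ 1 := by
    rw [ENNReal.coe_le_one_iff, ← NNReal.coe_le_coe]
    push_cast
    norm_num
  have h4 : ((17 / 18 : ℝ≥0) : ℝ≥0∞) ≤ 1 := by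
    rw [ENNReal.coe_le_one_iff, ← NNReal.coe_le_coe]
    push_cast
    norm_num
  have hpt : ∀ a b : ℕ, ind (b ≤ a + q) ≤ ((4 / 3 : ℝ≥0) : ℝ≥0∞) ^ q *
      (((4 / 3 : ℝ≥0) : ℝ≥0∞) ^ a * ((3 / 4 : ℝ≥0) : ℝ≥0∞) ^ b) := by
    intro a b
    by_cases h : b ≤ a + q
    · rw [ind_of h]
      calc (1 : ℝ≥0∞) = ((4 / 3 : ℝ≥0) : ℝ≥0∞) ^ (a + q) * ((3 / 4 : ℝ≥0) : ℝ≥0∞) ^ (a + q) := by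
            rw [← mul_pow, h1, one_pow]
        _ ≤ ((4 / 3 : ℝ≥0) : ℝ≥0∞) ^ (a + q) * ((3 / 4 : ℝ≥0) : ℝ≥0∞) ^ b :=
            mul_le_mul_right (pow_le_pow_right_of_le_one' h3 h) _
        _ = _ := by ring
    · rw [ind_of_not h]
      exact zero_le
  refine (expect_mono _ fun σ => hpt _ _).trans ?_
  rw [expect_mul_left]
  calc _ ≤ ((4 / 3 : ℝ≥0) : ℝ≥0∞) ^ q * ((17 / 18 : ℝ≥0) : ℝ≥0∞) ^ k :=
        mul_le_mul_right (expect_stack_le hd hG i k) _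
    _ ≤ ((4 / 3 : ℝ≥0) : ℝ≥0∞) ^ q * ((17 / 18 : ℝ≥0) : ℝ≥0∞) ^ (10 * q) :=
        mul_le_mul_right (pow_le_pow_right_of_le_one' h4 hq) _
    _ = (((4 / 3 : ℝ≥0) : ℝ≥0∞) * ((17 / 18 : ℝ≥0) : ℝ≥0∞) ^ 10) ^ q := by
        rw [mul_pow, pow_mul]
    _ ≤ _ := pow_le_pow_left' h2 q

/-- A sequence escapes linearly in its first `L` steps, on time scales from `r` on, as measured
by a function of the position that changes by at most one in each step. -/
def Escapes {V : Type*} (r L : ℕ) (f : ℕ → V) : Prop :=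
  ∃ g : V → ℕ, (∀ i < L, g (f (i + 1)) ≤ g (f i) + 1 ∧ g (f i) ≤ g (f (i + 1)) + 1) ∧
    ∀ i j, i + r ≤ j → j ≤ L → 10 * g (f i) + (j - i) ≤ 10 * g (f j)

/-- In a pendant walk the height of the stack depends on the current vertex alone, so it can serve
as the Lipschitz function `g` on vertices. -/
theorem PendantWalk.escapes {V : Type*} [DecidableEq V] {f : ℕ → V} {r L : ℕ}
    (h : PendantWalk f L) (hs : ∀ i j, i + r ≤ j → j ≤ L →
      10 * (stack f i).length + (j - i) ≤ 10 * (stack f j).length) : Escapes r L f := by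
  obtain ⟨A, h1, h2, -⟩ := exists_ancestors f L h
  refine ⟨fun v => (A v).length, fun i hi => ?_, fun i j hij hj => ?_⟩
  · dsimp only
    rcases h2 i hi with h | h <;> rw [h, List.length_cons] <;> omega
  · have := hs i j hij hj
    rwa [h1 i (by omega), h1 j hj] at this

/-- The walks in `G` from the first vertex that escape linearly in the first `L` steps. -/
structure GoodWalk {n : ℕ} [NeZero n] (G : SimpleGraph (Fin n)) (r L : ℕ) (f : ℕ → Fin n) :
    Prop where
  start : f 0 = 0
  adj : ∀ i < L, G.Adj (f i) (f (i + 1))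
  escapes : Escapes r L f

theorem four_fifths_pow_le {l q : ℕ} (hq : 10 * l ≤ q) :
    ((4 / 5 : ℝ≥0) : ℝ≥0∞) ^ q ≤ ((1 / 8 : ℝ≥0) : ℝ≥0∞) ^ l := by
  have h1 : ((4 / 5 : ℝ≥0) : ℝ≥0∞) ≤ 1 := by
    rw [ENNReal.coe_le_one_iff, ← NNReal.coe_le_coe]
    push_cast
    norm_num
  refine (pow_le_pow_right_of_le_one' h1 hq).trans ?_
  rw [pow_mul]
  refine pow_le_pow_left' ?_ l
  rw [← ENNReal.coe_pow, ENNReal.coe_le_coe, ← NNReal.coe_le_coe]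
  push_cast
  norm_num

theorem expect_not_escape_le {n d : ℕ} [NeZero n] (hd : 3 ≤ d) {G : SimpleGraph (Fin n)}
    (hG : G ∈ regularGraphs n d) (l L : ℕ) :
    expect (walk G L) (fun σ => ind (∃ ij ∈ Finset.range (L + 1) ×ˢ Finset.range (L + 1),
      ij.1 + 100 * l ≤ ij.2 ∧ 10 * (stack (extend σ) ij.2).length <
        10 * (stack (extend σ) ij.1).length + (ij.2 - ij.1))) ≤
      ((L + 1) * (L + 1) : ℕ) * ((1 / 8 : ℝ≥0) : ℝ≥0∞) ^ l := by
  refine (expect_mono _ fun σ => ind_exists_le _ _).trans ?_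
  rw [expect_finset_sum]
  refine (Finset.sum_le_card_nsmul _ _ (((1 / 8 : ℝ≥0) : ℝ≥0∞) ^ l) fun ij hij => ?_).trans ?_
  · obtain ⟨i, j⟩ := ij
    simp only [Finset.mem_product, Finset.mem_range] at hij
    by_cases hr : i + 100 * l ≤ j
    swap
    · refine (expect_mono _ fun σ => (ind_of_not fun h => hr h.1).le).trans ?_
      simp [expect]
    obtain ⟨k, rfl⟩ := Nat.exists_eq_add_of_le (show i ≤ j by omega)
    -- With `k ≥ 100 * l` the choice `q = k / 10` gives `q ≥ 10 * l`, and `(4 / 5) ^ 10 ≤ 1 / 8`.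
    refine le_trans ?_ ((expect_stack_slow_le hd hG (i := i) (k := k) (q := k / 10)
      (by omega)).trans (four_fifths_pow_le (by omega)))
    rw [expect_walk_prefix G (L := i + k) (l := L) (by omega)
      (fun f => ind (i + 100 * l ≤ i + k ∧ 10 * (stack f (i + k)).length <
        10 * (stack f i).length + (i + k - i)))]
    · refine expect_mono _ fun σ => ind_mono fun h => ?_
      omega
    · intro f f' hff
      rw [stack_congr hff, stack_congr (t := i) fun m hm => hff m (by omega)]
  · rw [Finset.card_product, Finset.card_range, nsmul_eq_mul]

theorem sum_not_goodWalk_le {n d K : ℕ} [NeZero n] {ε : ℝ≥0∞} (hd : 3 ≤ d)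
    (hε : EdgeUnlikely n d K ε) {l L : ℕ} (hLK : L ≤ K) (hLn : L ≤ n) :
    ∑ G ∈ regularGraphs n d, expect (walk G n)
        (fun σ => ind (¬GoodWalk G (100 * l) L (extend σ))) ≤
      ((L * L : ℕ) * ε + ((L + 1) * (L + 1) : ℕ) * ((1 / 8 : ℝ≥0) : ℝ≥0∞) ^ l) *
        (regularGraphs n d).card := by
  have hG : ∀ G ∈ regularGraphs n d, expect (walk G n)
        (fun σ => ind (¬GoodWalk G (100 * l) L (extend σ))) ≤
      expect (walk G L) (fun σ => ind (¬PendantWalk (extend σ) L)) +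
        ((L + 1) * (L + 1) : ℕ) * ((1 / 8 : ℝ≥0) : ℝ≥0∞) ^ l := by
    intro G hG
    rw [expect_walk_prefix G hLn (fun f => ind (¬GoodWalk G (100 * l) L f))]
    · refine le_trans ?_ (add_le_add_right (expect_not_escape_le hd hG l L) _)
      rw [← expect_add]
      refine expect_mono_support _ fun σ hσ => (ind_mono fun h => ?_).trans (ind_or_le _ _)
      by_contra! hcon
      obtain ⟨h1, h2⟩ := hcon
      obtain ⟨h3, h4⟩ := walk_support (by omega) hG L σ hσ
      refine h ⟨h3, h4, h1.escapes fun i j hij hj => ?_⟩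
      exact h2 (i, j) (by simp only [Finset.mem_product, Finset.mem_range]; omega) hij
    · have key : ∀ f f' : ℕ → Fin n, (∀ i ≤ L, f i = f' i) → GoodWalk G (100 * l) L f →
          GoodWalk G (100 * l) L f' := by
        rintro f f' hff ⟨h1, h2, g, h3, h4⟩
        refine ⟨by rw [← hff 0 (Nat.zero_le _), h1], fun i hi => ?_, g, fun i hi => ?_,
          fun i j hij hj => ?_⟩
        · rw [← hff i hi.le, ← hff (i + 1) hi]; exact h2 i hi
        · rw [← hff i hi.le, ← hff (i + 1) hi]; exact h3 i hi
        · rw [← hff i (by omega), ← hff j hj]; exact h4 i j hij hj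
      intro f f' hff
      rw [show GoodWalk G (100 * l) L f = GoodWalk G (100 * l) L f' from
        propext ⟨key f f' hff, key f' f fun i hi => (hff i hi).symm⟩]
  refine (Finset.sum_le_sum hG).trans ?_
  rw [Finset.sum_add_distrib, Finset.sum_const, nsmul_eq_mul,
    add_mul _ _ ((regularGraphs n d).card : ℝ≥0∞), mul_comm ((regularGraphs n d).card : ℝ≥0∞)]
  exact add_le_add_left (sum_not_pendantWalk_le (by omega) hε L hLK) _

/-! ### The adaptive query sequence -/

section Strategy

variable {n : ℕ}

/-- The time `i`, truncated to the length of the walk. -/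
def toTime (n i : ℕ) : Time n := ⟨min i n, Nat.lt_succ_of_le (Nat.min_le_right i n)⟩

/-- The answers in a transcript as a partial function on `ℕ`. -/
def known (tr : Transcript n) (i : ℕ) : Option (Fin n) := tr.toPartialWalk (toTime n i)

theorem mem_of_known {tr : Transcript n} {i : ℕ} {v : Fin n} (h : known tr i = some v) :
    v ∈ (tr.answers.map Prod.snd).toFinset := by
  obtain ⟨l₁, l₂, h1, -⟩ := List.lookup_eq_some_iff.1 h
  rw [List.mem_toFinset, List.mem_map]
  exact ⟨(toTime n i, v), by rw [h1]; simp, rfl⟩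

variable [NeZero n]

/-- The search in the graph with the edges in `S`, with origin at the first vertex. -/
def searchIn (S : Finset (Sym2 (Fin n))) (r R k j : ℕ) : QueryTree (Fin n) :=
  QueryTree.search (fun v => (edgeGraph S).dist 0 v) (fun b v => Separates (edgeGraph S) 0 b v)
    r R k j 0

/-- The progress of the search in the revealed graph. -/
def progress (r R k j : ℕ) (tr : Transcript n) : ℕ × Option ℕ :=
  QueryTree.scan (known tr) (searchIn tr.revealed r R k j)

/-- The adaptive sequence of at most `D` queries that carries out the search. -/
def strategy (r R k j D : ℕ) : AdaptiveSequence n where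
  next tr := (progress r R k j tr).2.map (toTime n)
  fresh tr t h := by
    obtain ⟨i, hi, rfl⟩ := Option.map_eq_some_iff.1 h
    have h0 : tr.answers.lookup (toTime n i) = none := QueryTree.eq_none_of_scan hi
    intro hmem
    obtain ⟨⟨t, v⟩, hx, rfl⟩ := List.mem_map.1 hmem
    have := List.lookup_eq_none_iff.1 h0 _ hx
    simp at this
  maxQueries := D

/-- The vertices that were returned or are incident with a revealed edge, and the origin. -/
def marked (tr : Transcript n) : Finset (Fin n) :=
  insert 0 ((tr.answers.map Prod.snd).toFinset ∪ tr.revealed.biUnion Sym2.toFinset)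

theorem endpointsIn_marked (tr : Transcript n) : EndpointsIn tr.revealed (marked tr) := by
  intro e he v hv
  refine Finset.mem_insert_of_mem (Finset.mem_union_right _ ?_)
  exact Finset.mem_biUnion.2 ⟨e, he, Sym2.mem_toFinset.2 hv⟩

theorem card_marked_le (tr : Transcript n) :
    (marked tr).card ≤ 1 + tr.answers.length + 2 * tr.revealed.card := by
  have h1 := Finset.card_insert_le 0
    ((tr.answers.map Prod.snd).toFinset ∪ tr.revealed.biUnion Sym2.toFinset)
  have h2 := Finset.card_union_le (tr.answers.map Prod.snd).toFinset
    (tr.revealed.biUnion Sym2.toFinset)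
  have h3 := List.toFinset_card_le (tr.answers.map Prod.snd)
  have h4 : (tr.revealed.biUnion Sym2.toFinset).card ≤ tr.revealed.card * 2 :=
    Finset.card_biUnion_le_card_mul _ _ _ fun e _ => by
      rw [Sym2.card_toFinset]; split_ifs <;> omega
  rw [List.length_map] at h3
  unfold marked
  omega

/-- One more answer in a pendant extension of the revealed graph is progress. -/
theorem progress_lt {r R k j : ℕ} {tr : Transcript n} {i : ℕ}
    (hi : (progress r R k j tr).2 = some i) (v : Fin n) {S' : Finset (Sym2 (Fin n))}
    (hS' : Pendant (marked tr) tr.revealed S') :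
    (progress r R k j tr).1 + 1 ≤
      (progress r R k j ⟨tr.answers ++ [(toTime n i, v)], S'⟩).1 := by
  have h0 : (0 : Fin n) ∈ marked tr := Finset.mem_insert_self _ _
  have hmem : ∀ i v, known tr i = some v → v ∈ marked tr := fun i v h =>
    Finset.mem_insert_of_mem (Finset.mem_union_left _ (mem_of_known h))
  -- The tree is rebuilt from the current revealed graph after each answer. Its scan does not change
  -- under a pendant extension, since the search consults only relations among marked vertices.
  have hcongr : progress r R k j tr = QueryTree.scan (known tr) (searchIn S' r R k j) := by
    refine QueryTree.scan_search_congr (fun i v hv => ?_) (fun i a i' b ha hb => ?_) _ _ _ _ _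
    · exact (hS'.dist_eq (endpointsIn_marked tr) h0 (hmem i v hv)).symm
    · exact (hS'.separates_iff (endpointsIn_marked tr) h0 (hmem _ _ hb)).symm
  have hnone : tr.answers.lookup (toTime n i) = none := QueryTree.eq_none_of_scan hi
  rw [hcongr] at hi ⊢
  refine QueryTree.scan_fst_lt (fun l w hl => ?_) hi (v := v) ?_
  · have hl : tr.answers.lookup (toTime n l) = some w := hl
    change (tr.answers ++ [(toTime n i, v)]).lookup (toTime n l) = some w
    rw [List.lookup_append, hl, Option.some_or]
  · change (tr.answers ++ [(toTime n i, v)]).lookup (toTime n i) = some v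
    rw [List.lookup_append, hnone, Option.none_or, List.lookup_cons_self]

/-- The partial walks that can be completed to a good walk. -/
def Plausible (G : SimpleGraph (Fin n)) (r L : ℕ) (x : PartialWalk n) : Prop :=
  ∃ σ : Time n → Fin n, GoodWalk G r L (extend σ) ∧ ∀ t v, x t = some v → σ t = v

theorem exists_unrevealed_edge {r R k j : ℕ} {G : SimpleGraph (Fin n)} {tr : Transcript n}
    (hac : (edgeGraph tr.revealed).IsAcyclic) (hR : R = 23 * r) (hr : 0 < r)
    (hcard : 20 * tr.revealed.card ≤ R * 2 ^ k) (hj : R * 2 ^ k ≤ 2 ^ j)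
    (hfin : (progress r R k j tr).2 = none)
    (hx : Plausible G r (R * 2 ^ k) tr.toPartialWalk) :
    ∃ ab ∈ (tr.answers.map Prod.snd).toFinset ×ˢ (tr.answers.map Prod.snd).toFinset,
      s(ab.1, ab.2) ∉ tr.revealed ∧ G.Adj ab.1 ab.2 := by
  obtain ⟨σ, hσ, hxσ⟩ := hx
  obtain ⟨g, hg, hslope⟩ := hσ.escapes
  have h0 := hσ.start
  have hfin' : (QueryTree.scan (known tr) (QueryTree.search
      (fun v => (edgeGraph tr.revealed).dist (extend σ 0) v)
      (fun b v => Separates (edgeGraph tr.revealed) (extend σ 0) b v) r R k j 0)).2 = none := by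
    rw [h0]; exact hfin
  obtain ⟨i, hi, h1, h2, h3⟩ := QueryTree.search_finished (σ := extend σ) hac
    (fun i v hv => (hxσ _ _ hv).symm) hR hr hcard hj g hg hslope hfin'
  have hadj := hσ.adj i hi
  refine ⟨(extend σ i, extend σ (i + 1)), Finset.mem_product.2 ⟨mem_of_known h1, mem_of_known h2⟩,
    fun hmem => h3 (edgeGraph_adj.2 ⟨hmem, hadj.ne⟩), hadj⟩

/-- A union bound over all pairs of returned vertices: a plausible transcript with a finished search
must contain an unrevealed edge, and the answers were fixed while the graph is still uniform given
the revealed edges. -/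
theorem sum_plausible_le {d K D r R k j : ℕ} {ε : ℝ≥0∞}
    (hε : EdgeUnlikely n d K ε) {tr : Transcript n} (hK : tr.revealed.card ≤ K)
    (hac : (edgeGraph tr.revealed).IsAcyclic) (hR : R = 23 * r) (hr : 0 < r)
    (hcard : 20 * tr.revealed.card ≤ R * 2 ^ k) (hj : R * 2 ^ k ≤ 2 ^ j)
    (hfin : (progress r R k j tr).2 = none) (hD : tr.answers.length ≤ D) :
    ∑ G ∈ containing n d tr.revealed, ind (Plausible G r (R * 2 ^ k) tr.toPartialWalk) ≤
      (D * D : ℕ) * (d * ε) * (containing n d tr.revealed).card := by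
  set X := (tr.answers.map Prod.snd).toFinset with hX
  have hXc : X.card ≤ D :=
    (List.toFinset_card_le _).trans ((List.length_map _).trans_le hD)
  have hpair : ∀ ab : Fin n × Fin n, ∑ G ∈ containing n d tr.revealed,
      ind (s(ab.1, ab.2) ∉ tr.revealed ∧ G.Adj ab.1 ab.2) ≤
      d * ε * (containing n d tr.revealed).card := by
    intro ab
    by_cases hin : s(ab.1, ab.2) ∈ tr.revealed
    · rw [Finset.sum_eq_zero fun G _ => ind_of_not fun h => h.1 hin]
      exact zero_le
    refine le_trans ?_ (hε _ _ _ hK hin)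
    classical
    have : containing n d (insert s(ab.1, ab.2) tr.revealed) =
        (containing n d tr.revealed).filter fun G => G.Adj ab.1 ab.2 := by
      ext G
      rw [mem_containing_insert, Finset.mem_filter]
    rw [this, Finset.card_filter, Nat.cast_sum]
    refine Finset.sum_le_sum fun G _ => ?_
    by_cases hG : G.Adj ab.1 ab.2
    · rw [if_pos hG, Nat.cast_one]; exact ind_le_one _
    · rw [ind_of_not fun h => hG h.2]; exact zero_le
  calc _ ≤ ∑ G ∈ containing n d tr.revealed, ∑ ab ∈ X ×ˢ X,
        ind (s(ab.1, ab.2) ∉ tr.revealed ∧ G.Adj ab.1 ab.2) := by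
        refine Finset.sum_le_sum fun G _ => (ind_mono fun h => ?_).trans (ind_exists_le _ _)
        exact exists_unrevealed_edge hac hR hr hcard hj hfin h
    _ = ∑ ab ∈ X ×ˢ X, ∑ G ∈ containing n d tr.revealed,
        ind (s(ab.1, ab.2) ∉ tr.revealed ∧ G.Adj ab.1 ab.2) := Finset.sum_comm
    _ ≤ (X ×ˢ X).card • (d * ε * ((containing n d tr.revealed).card : ℝ≥0∞)) :=
        Finset.sum_le_card_nsmul _ _ _ fun ab _ => hpair ab
    _ ≤ _ := by
        rw [nsmul_eq_mul, Finset.card_product, ← mul_assoc]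
        gcongr

/-- An algorithm with few probes hardly ever answers the queries of the strategy plausibly. -/
theorem sum_interact_le {d K D r R k j m M : ℕ} {ε : ℝ≥0∞} (hd : 0 < d)
    (hε : EdgeUnlikely n d K ε) (hR : R = 23 * r) (hr : 0 < r) (hMK : M ≤ K)
    (hcard : 20 * M ≤ R * 2 ^ k) (hj : R * 2 ^ k ≤ 2 ^ j)
    (hdepth : 2 * k + (R + 1 + (j + 2)) ≤ D)
    (A : Algorithm n) (hA : ∀ s t, (A.respond s t).ProbesAtMost m) :
    ∀ (c : ℕ) (s : A.State) (tr : Transcript n), (edgeGraph tr.revealed).IsAcyclic →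
      D ≤ (progress r R k j tr).1 + c → tr.answers.length + c ≤ D →
      tr.revealed.card + c * m ≤ M →
      ∑ G ∈ containing n d tr.revealed, expect (interact G A (strategy r R k j D) c s tr)
          (fun tr' => ind (Plausible G r (R * 2 ^ k) tr'.toPartialWalk)) ≤
        ((D * D : ℕ) * (d * ε) + (c * (m * (1 + D + 2 * M + 2 * m)) : ℕ) * ε) *
          (containing n d tr.revealed).card := by
  intro c
  have hlast : ∀ (c : ℕ) (tr : Transcript n), (edgeGraph tr.revealed).IsAcyclic →
      tr.answers.length + c ≤ D → tr.revealed.card + c * m ≤ M →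
      (progress r R k j tr).2 = none →
      ∑ G ∈ containing n d tr.revealed, ind (Plausible G r (R * 2 ^ k) tr.toPartialWalk) ≤
        ((D * D : ℕ) * (d * ε) + (c * (m * (1 + D + 2 * M + 2 * m)) : ℕ) * ε) *
          (containing n d tr.revealed).card := by
    intro c tr hac hlen hrev hfin
    have hc : tr.revealed.card ≤ M := by omega
    refine (sum_plausible_le (D := D) hε (hc.trans hMK) hac hR hr (by omega) hj hfin (by omega)).trans ?_
    gcongr
    exact le_self_add
  induction c with
  | zero =>
    intro s tr hac hprog hlen hrev
    simp only [interact, expect_pure]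
    -- No queries are left, so the progress has reached the depth of the tree and the search is
    -- finished.
    exact hlast 0 tr hac hlen hrev
      (QueryTree.scan_snd_eq_none _ (QueryTree.depthLE_search _ _ _ _ _ _ _) (hdepth.trans hprog))
  | succ c ih =>
    intro s tr hac hprog hlen hrev
    cases hnext : (progress r R k j tr).2 with
    | none =>
      have hn : (strategy r R k j D).next tr = none := by
        change (progress r R k j tr).2.map _ = none
        rw [hnext]; rfl
      simp only [interact, hn, expect_pure]
      exact hlast (c + 1) tr hac hlen hrev hnext
    | some i =>
      have hn : (strategy r R k j D).next tr = some (toTime n i) := by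
        change (progress r R k j tr).2.map _ = _
        rw [hnext]; rfl
      simp only [interact, hn, expect_bind]
      have hrev' : tr.revealed.card + m + c * m ≤ M := by
        rw [Nat.succ_mul] at hrev; omega
      refine (sum_run_le hd hε ((D * D : ℕ) * (d * ε) +
          (c * (m * (1 + D + 2 * M + 2 * m)) : ℕ) * ε)
        (fun (a : Fin n × A.State) S' G => expect (interact G A (strategy r R k j D) c a.2
          ⟨tr.answers ++ [(toTime n i, a.1)], S'⟩)
          (fun tr' => ind (Plausible G r (R * 2 ^ k) tr'.toPartialWalk)))
        (fun _ _ _ => expect_le_one _ fun _ => ind_le_one _) (A.respond s (toTime n i)) m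
        tr.revealed (marked tr) (hA _ _) (endpointsIn_marked tr) (by omega) ?_).trans ?_
      · intro a S' hS' hS'c
        refine ih a.2 ⟨tr.answers ++ [(toTime n i, a.1)], S'⟩
          (hS'.isAcyclic (endpointsIn_marked tr) hac) ?_ ?_ ?_
        · have := progress_lt hnext a.1 hS'
          omega
        · simp only [List.length_append, List.length_singleton]
          omega
        · dsimp only
          omega
      · have hW := card_marked_le tr
        rw [add_assoc, ← add_mul, ← Nat.cast_add]
        have hc : c * (m * (1 + D + 2 * M + 2 * m)) + m * ((marked tr).card + 2 * m) ≤
            (c + 1) * (m * (1 + D + 2 * M + 2 * m)) := by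
          rw [Nat.add_mul c 1, one_mul]
          gcongr
          omega
        gcongr

end Strategy

/-! ### Choice of the parameters -/

theorem exists_forall_mul_log_sq_le (c : ℕ) :
    ∃ n₀ : ℕ, ∀ n ≥ n₀, c * (Nat.log 2 n + 1) ^ 2 ≤ n := by
  have h := tendsto_pow_const_div_const_pow_of_one_lt 2 (r := (2 : ℝ)) (by norm_num)
  have h1 := h.eventually (eventually_lt_nhds (b := 1 / (2 * c + 1 : ℝ)) (by positivity))
  obtain ⟨a, ha⟩ := Filter.eventually_atTop.1 h1
  refine ⟨2 ^ a, fun n hn => ?_⟩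
  have hn0 : n ≠ 0 := by
    have := Nat.one_le_two_pow (n := a)
    omega
  have hlog : a ≤ Nat.log 2 n := (Nat.le_log_iff_pow_le (by norm_num) hn0).2 hn
  have h2 := ha (Nat.log 2 n + 1) (by omega)
  rw [div_lt_div_iff₀ (by positivity) (by positivity), one_mul] at h2
  have h3 : (Nat.log 2 n + 1) ^ 2 * (2 * c + 1) < 2 ^ (Nat.log 2 n + 1) := by exact_mod_cast h2
  have h4 : 2 ^ Nat.log 2 n ≤ n := Nat.pow_log_le_self 2 hn0
  rw [pow_succ 2] at h3
  nlinarith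

theorem log_add_one_le {n : ℕ} (hn : 3 ≤ n) : ((Nat.log 2 n + 1 : ℕ) : ℝ) ≤ 3 * Real.log n := by
  have hn0 : (0 : ℝ) < n := by positivity
  have h1 : (1 : ℝ) ≤ Real.log n := by
    rw [Real.le_log_iff_exp_le hn0]
    have h3 : (3 : ℝ) ≤ n := by exact_mod_cast hn
    have := Real.exp_one_lt_d9
    linarith
  have h2 : (Nat.log 2 n : ℝ) * Real.log 2 ≤ Real.log n := by
    rw [← Real.log_pow]
    refine Real.log_le_log (by positivity) ?_
    exact_mod_cast Nat.pow_log_le_self 2 (by omega)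
  have h3 := Real.log_two_gt_d9
  push_cast
  have h4 : (Nat.log 2 n : ℝ) * (1 / 2) ≤ (Nat.log 2 n : ℝ) * Real.log 2 := by
    gcongr
    linarith
  linarith

theorem edgeUnlikely {n d : ℕ} [NeZero n] (hd : 3 ≤ d) (hn : 4 * ((d + 2) * d) ≤ n) :
    EdgeUnlikely n d (n / 2) ((2 / n : ℝ≥0) : ℝ≥0∞) := by
  intro S u w hS huw
  have h := card_containing_insert_le (n := n) (d := d) (by omega) huw (by
    have : n * 3 ≤ n * d := Nat.mul_le_mul_left n hd
    omega)
  have hn0 : (n : ℝ≥0) ≠ 0 := by exact_mod_cast NeZero.ne n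
  have h' : ((containing n d (insert s(u, w) S)).card : ℝ≥0) ≤
      d * (2 / n) * (containing n d S).card := by
    have h2 : (n : ℝ≥0) * (containing n d (insert s(u, w) S)).card ≤
        2 * d * (containing n d S).card := by exact_mod_cast h
    calc ((containing n d (insert s(u, w) S)).card : ℝ≥0)
        = (n : ℝ≥0)⁻¹ * (n * (containing n d (insert s(u, w) S)).card) := by
          rw [inv_mul_cancel_left₀ hn0]
      _ ≤ (n : ℝ≥0)⁻¹ * (2 * d * (containing n d S).card) := by gcongr
      _ = _ := by rw [div_eq_mul_inv]; ring
  generalize (2 / n : ℝ≥0) = e at h'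
  exact_mod_cast h'

/-! ### Comparison of distributions -/

theorem evalDist_eq_expect {n : ℕ} (F : PartialWalk n → Bool) (P : PMF (PartialWalk n)) :
    evalDist F P = (expect P fun x => ind (F x = true)).toReal := by
  rw [evalDist, map_apply_eq_expect]

theorem evalDist_eq_sum {n : ℕ} (F : PartialWalk n → Bool) (P : PMF (PartialWalk n)) :
    evalDist F P = ∑ x, (P x).toReal * (ind (F x = true)).toReal := by
  rw [evalDist_eq_expect, expect, tsum_fintype, ENNReal.toReal_sum]
  · simp_rw [ENNReal.toReal_mul]
  · intro x _
    exact ENNReal.mul_ne_top (P.apply_ne_top x) (ne_top_of_le_ne_top ENNReal.one_ne_top (ind_le_one _))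

theorem abs_evalDist_sub_le {n : ℕ} (F : PartialWalk n → Bool) (P P' : PMF (PartialWalk n)) :
    |evalDist F P - evalDist F P'| ≤ l1Dist P' P := by
  rw [evalDist_eq_sum, evalDist_eq_sum, ← Finset.sum_sub_distrib, l1Dist]
  refine (Finset.abs_sum_le_sum_abs _ _).trans (Finset.sum_le_sum fun x _ => ?_)
  rw [← sub_mul, abs_mul, abs_sub_comm]
  refine mul_le_of_le_one_right (abs_nonneg _) ?_
  rw [abs_of_nonneg ENNReal.toReal_nonneg]
  exact ENNReal.toReal_le_of_le_ofReal zero_le_one (by simpa using ind_le_one _)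

theorem expect_ind_ne_top {α : Type*} (P : PMF α) (f : α → Prop) :
    expect P (fun x => ind (f x)) ≠ ⊤ :=
  ne_top_of_le_ne_top ENNReal.one_ne_top (expect_le_one _ fun _ => ind_le_one _)

theorem expect_ind_not {α : Type*} (P : PMF α) (f : α → Prop) :
    (expect P fun x => ind (¬f x)).toReal = 1 - (expect P fun x => ind (f x)).toReal := by
  have h : (expect P fun x => ind (¬f x)) + (expect P fun x => ind (f x)) = 1 := by
    rw [← expect_add, ← expect_const P 1]
    congr 1
    funext x
    by_cases hx : f x
    · rw [ind_of hx, ind_of_not (not_not.2 hx), zero_add]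
    · rw [ind_of_not hx, ind_of hx, add_zero]
  have := congrArg ENNReal.toReal h
  rw [ENNReal.toReal_add (expect_ind_ne_top _ _) (expect_ind_ne_top _ _), ENNReal.toReal_one] at this
  linarith

theorem sum_toReal_le {ι : Type*} (s : Finset ι) (f : ι → ℝ≥0∞) (hf : ∀ i, f i ≠ ⊤) {a : ℝ≥0∞}
    {b : ℝ≥0} (N : ℕ) (h : ∑ i ∈ s, f i ≤ a * N) (hab : a ≤ b) :
    ∑ i ∈ s, (f i).toReal ≤ b * N := by
  rw [← ENNReal.toReal_sum fun i _ => hf i]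
  have h1 : ∑ i ∈ s, f i ≤ ((b * N : ℝ≥0) : ℝ≥0∞) := by
    push_cast
    exact h.trans (by gcongr)
  have := ENNReal.toReal_mono ENNReal.coe_ne_top h1
  simpa using this

open Classical in
/-- The test that rejects, with value `true`, the partial walks that are not plausible. -/
def rejects {n : ℕ} [NeZero n] (r L : ℕ) (G : SimpleGraph (Fin n)) (x : PartialWalk n) : Bool :=
  decide (¬Plausible G r L x)

theorem rejects_eq_true {n : ℕ} [NeZero n] {r L : ℕ} {G : SimpleGraph (Fin n)}
    {x : PartialWalk n} : rejects r L G x = true ↔ ¬Plausible G r L x := by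
  simp [rejects]

/-- A good walk is itself a completion of each of its projections, so the rule for the times plays
no role, even if it depends on the walk. -/
theorem expect_trueAnswers_le {n : ℕ} [NeZero n] (r L : ℕ) (G : SimpleGraph (Fin n))
    (τ : TimeRule n) :
    expect (trueAnswers G τ) (fun x => ind (¬Plausible G r L x)) ≤
      expect (walk G n) fun σ => ind (¬GoodWalk G r L (extend σ)) := by
  rw [trueAnswers, expect_bind]
  refine expect_mono _ fun σ => ?_
  rw [expect_map, ← expect_const (τ σ) (ind (¬GoodWalk G r L (extend σ)))]
  refine expect_mono _ fun T => ind_mono fun h hσ => h ⟨σ, hσ, fun t v ht => ?_⟩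
  unfold project at ht
  split_ifs at ht
  exact Option.some.inj ht

/-- If good walks are likely and plausible responses unlikely, the test distinguishes them. -/
theorem le_expectRegular {n d r L : ℕ} [NeZero n] (hne : (regularGraphs n d).Nonempty)
    (A : Algorithm n) (Q : AdaptiveSequence n) (τ : SimpleGraph (Fin n) → TimeRule n)
    {a b : ℝ≥0∞} {a' b' : ℝ≥0} (ha' : a ≤ a') (hb' : b ≤ b')
    (ha : ∑ G ∈ regularGraphs n d, expect (walk G n)
      (fun σ => ind (¬GoodWalk G r L (extend σ))) ≤ a * (regularGraphs n d).card)
    (hb : ∑ G ∈ regularGraphs n d, expect (interact G A Q Q.maxQueries A.start ⟨[], ∅⟩)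
      (fun tr => ind (Plausible G r L tr.toPartialWalk)) ≤ b * (regularGraphs n d).card) :
    1 - (a' : ℝ) - b' ≤ expectRegular n d fun G =>
      |evalDist (rejects r L G) (trueAnswers G (τ G)) -
        evalDist (rejects r L G) (responses G A Q)| := by
  have hcard : (0 : ℝ) < (regularGraphs n d).card := by exact_mod_cast hne.card_pos
  have hA := sum_toReal_le _ _ (fun G => expect_ind_ne_top _ _) _
    ((Finset.sum_le_sum fun G _ => expect_trueAnswers_le r L G (τ G)).trans ha) ha'
  have hB := sum_toReal_le _ _ (fun G => expect_ind_ne_top _ _) _ hb hb'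
  rw [expectRegular, le_div_iff₀ hcard]
  have hG : ∀ G ∈ regularGraphs n d,
      1 - (expect (trueAnswers G (τ G)) fun x => ind (¬Plausible G r L x)).toReal -
        (expect (interact G A Q Q.maxQueries A.start ⟨[], ∅⟩)
          fun tr => ind (Plausible G r L tr.toPartialWalk)).toReal ≤
      |evalDist (rejects r L G) (trueAnswers G (τ G)) -
        evalDist (rejects r L G) (responses G A Q)| := by
    intro G _
    rw [evalDist_eq_expect, evalDist_eq_expect, abs_sub_comm]
    simp only [rejects_eq_true]
    refine le_trans ?_ (le_abs_self _)
    rw [expect_ind_not (responses G A Q), responses, expect_map]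
    linarith
  refine le_trans ?_ (Finset.sum_le_sum hG)
  rw [Finset.sum_sub_distrib, Finset.sum_sub_distrib, Finset.sum_const, nsmul_eq_mul, mul_one]
  linarith

/-! ### The lower bound -/

/-- The upper bound on the scale keeps the true walk pendant; the lower bound leaves room for the
probes in `20 * M ≤ L`. -/
theorem exists_scale {s R : ℕ} (hR : 0 < R) (hs : R ≤ s / 40) :
    ∃ k, 40 * (R * 2 ^ k) ≤ s ∧ s < 80 * (R * 2 ^ k) := by
  refine ⟨Nat.log 2 (s / 40 / R), ?_, ?_⟩
  · have h1 : 2 ^ Nat.log 2 (s / 40 / R) ≤ s / 40 / R :=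
      Nat.pow_log_le_self 2 (Nat.div_pos hs hR).ne'
    have h2 := Nat.mul_le_mul_left R h1
    have h3 := Nat.mul_div_le (s / 40) R
    omega
  · have h1 : s / 40 / R < 2 ^ (Nat.log 2 (s / 40 / R) + 1) :=
      Nat.lt_pow_succ_log_self (by norm_num) _
    rw [Nat.div_lt_iff_lt_mul hR, pow_succ] at h1
    have h2 : 2 ^ Nat.log 2 (s / 40 / R) * 2 * R = 2 * (R * 2 ^ Nat.log 2 (s / 40 / R)) := by ring
    omega

theorem walk_error_le {n l L : ℕ} (hn : 1000 ≤ n) (hl : n ≤ 2 ^ l) (hL : 1600 * (L * L) ≤ n)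
    (hL' : (L + 1) * (L + 1) ≤ n) :
    ((L * L : ℕ) : ℝ≥0∞) * ((2 / n : ℝ≥0) : ℝ≥0∞) +
      ((L + 1) * (L + 1) : ℕ) * ((1 / 8 : ℝ≥0) : ℝ≥0∞) ^ l ≤ ((3 / 1000 : ℝ≥0) : ℝ≥0∞) := by
  have h : ((L * L : ℕ) : ℝ≥0) * (2 / n : ℝ≥0) +
      ((L + 1) * (L + 1) : ℕ) * (1 / 8 : ℝ≥0) ^ l ≤ 3 / 1000 := by
    rw [← NNReal.coe_le_coe]
    push_cast
    have hn0 : (1000 : ℝ) ≤ n := by exact_mod_cast hn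
    have hL : (1600 * (L * L) : ℝ) ≤ n := by exact_mod_cast hL
    have hL' : ((L + 1) * (L + 1) : ℝ) ≤ n := by exact_mod_cast hL'
    have hl : (n : ℝ) ≤ 2 ^ l := by exact_mod_cast hl
    have h1 : (L * L : ℝ) * (2 / n) ≤ 1 / 800 := by
      rw [← mul_div_assoc, div_le_iff₀ (by linarith)]
      linarith
    have h2 : (1 / 8 : ℝ) ^ l ≤ 1 / n * (1 / n) := by
      have h3 : (1 / 2 : ℝ) ^ l ≤ 1 / n := by
        rw [one_div_pow]
        exact one_div_le_one_div_of_le (by linarith) hl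
      calc (1 / 8 : ℝ) ^ l ≤ (1 / 2 * (1 / 2)) ^ l := by gcongr; norm_num
        _ = (1 / 2 : ℝ) ^ l * (1 / 2) ^ l := mul_pow _ _ _
        _ ≤ _ := by gcongr
    have h3 : ((L + 1) * (L + 1) : ℝ) * (1 / 8) ^ l ≤ 1 / 1000 := by
      calc ((L + 1) * (L + 1) : ℝ) * (1 / 8) ^ l ≤ n * (1 / n * (1 / n)) := by gcongr
        _ = 1 / n := by field_simp
        _ ≤ 1 / 1000 := one_div_le_one_div_of_le (by norm_num) hn0
    linarith
  generalize (2 / n : ℝ≥0) = e at h ⊢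
  generalize (1 / 8 : ℝ≥0) = x at h ⊢
  generalize (3 / 1000 : ℝ≥0) = y at h ⊢
  exact_mod_cast h

theorem response_error_le {n d D m s : ℕ} (hn : 0 < n) (hs : s * s ≤ n) (hD : D + 1 ≤ s)
    (hDd : 2000 * (D * D * d) ≤ n) (hM : 800 * (D * m) ≤ s) (hD0 : 0 < D) :
    ((D * D : ℕ) : ℝ≥0∞) * (d * ((2 / n : ℝ≥0) : ℝ≥0∞)) +
      (D * (m * (1 + D + 2 * (D * m) + 2 * m)) : ℕ) * ((2 / n : ℝ≥0) : ℝ≥0∞) ≤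
      ((6 / 1000 : ℝ≥0) : ℝ≥0∞) := by
  -- All probes together number at most `s / 800`, and each sees at most `2 * s` vertices, with `s *
  -- s ≤ n`.
  have hnat : D * (m * (1 + D + 2 * (D * m) + 2 * m)) * 400 ≤ n := by
    have h1 : m ≤ D * m := Nat.le_mul_of_pos_left m hD0
    calc D * (m * (1 + D + 2 * (D * m) + 2 * m)) * 400
        = 400 * (D * m) * (1 + D + 2 * (D * m) + 2 * m) := by ring
      _ ≤ 400 * (D * m) * (2 * s) := by gcongr; omega
      _ = 800 * (D * m) * s := by ring
      _ ≤ s * s := by gcongr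
      _ ≤ n := hs
  have h : ((D * D : ℕ) : ℝ≥0) * (d * (2 / n : ℝ≥0)) +
      (D * (m * (1 + D + 2 * (D * m) + 2 * m)) : ℕ) * (2 / n : ℝ≥0) ≤ 6 / 1000 := by
    generalize D * (m * (1 + D + 2 * (D * m) + 2 * m)) = Y at hnat
    rw [← NNReal.coe_le_coe]
    push_cast
    have hn0 : (0 : ℝ) < n := by exact_mod_cast hn
    have hDd : (2000 * (D * D * d) : ℝ) ≤ n := by exact_mod_cast hDd
    have hnat : (Y * 400 : ℝ) ≤ n := by exact_mod_cast hnat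
    have h1 : (D * D * (d * (2 / n)) : ℝ) ≤ 1 / 1000 := by
      rw [show (D * D * (d * (2 / n)) : ℝ) = D * D * d * 2 / n by ring, div_le_iff₀ hn0]
      linarith
    have h2 : (Y * (2 / n) : ℝ) ≤ 5 / 1000 := by
      rw [← mul_div_assoc, div_le_iff₀ hn0]
      linarith
    linarith
  generalize (2 / n : ℝ≥0) = e at h ⊢
  generalize (6 / 1000 : ℝ≥0) = y at h ⊢
  exact_mod_cast h

theorem lower_bound {n d l k : ℕ} [NeZero n] (hd : 3 ≤ d) (hl : l = Nat.log 2 n + 1)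
    (hnd : Even (n * d)) (hn1 : 4 * ((d + 2) * d) ≤ n) (hn2 : (200000 * 200000 * d) * l ^ 2 ≤ n)
    (hk1 : 40 * (2300 * l * 2 ^ k) ≤ Nat.sqrt n) (hk2 : Nat.sqrt n < 80 * (2300 * l * 2 ^ k))
    (A : Algorithm n)
    (hA : A.ProbesFewerThan (Real.sqrt n / (11200000 * Real.log n)))
    (τ : SimpleGraph (Fin n) → TimeRule n) :
    0.991 ≤ expectRegular n d fun G =>
      |evalDist (rejects (100 * l) (2300 * l * 2 ^ k) G) (trueAnswers G (τ G)) -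
        evalDist (rejects (100 * l) (2300 * l * 2 ^ k) G)
          (responses G A (strategy (100 * l) (2300 * l) k l (2310 * l)))| := by
  obtain ⟨m, hm, hAm⟩ := hA
  have hl0 : 0 < l := by omega
  have hn3 : 3 ≤ n := by nlinarith
  have hn1000 : 1000 ≤ n := by nlinarith [Nat.one_le_pow 2 l hl0]
  have hnl : n < 2 ^ l := by rw [hl]; exact Nat.lt_pow_succ_log_self (by norm_num) n
  set L := 2300 * l * 2 ^ k with hL
  set s := Nat.sqrt n with hs
  have hss : s * s ≤ n := Nat.sqrt_le n
  have hss' : n < (s + 1) * (s + 1) := Nat.lt_succ_sqrt n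
  have hls : 200000 * l ≤ s := by
    rw [hs, Nat.le_sqrt]
    refine le_trans ?_ hn2
    nlinarith [Nat.zero_le (l ^ 2)]
  have hsn : s ≤ n := Nat.sqrt_le_self n
  have hLpos : 0 < L := by omega
  have h2kL : 2 ^ k ≤ L := by
    rw [hL]
    exact Nat.le_mul_of_pos_left _ (by omega)
  have hkl : k ≤ l := by
    have : 2 ^ k < 2 ^ l := by omega
    exact ((Nat.pow_lt_pow_iff_right (by norm_num)).1 this).le
  -- With `l ≤ 3 * log n` and `√n ≤ 80 * L` this needs `20 * 2310 * 3 * 80 = 11088000`, which is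
  -- below the constant `11200000` in the bound on the probes.
  have hprobes : 20 * (2310 * l * m) ≤ L := by
    have hlog := log_add_one_le hn3
    rw [← hl] at hlog
    have hlogpos : 0 < Real.log n := by
      have : (0 : ℝ) < l := by exact_mod_cast hl0
      linarith
    rw [lt_div_iff₀ (by positivity)] at hm
    have hsqrt : Real.sqrt n ≤ 80 * L := by
      rw [Real.sqrt_le_left (by positivity)]
      have h1 : (n : ℝ) ≤ (s + 1) * (s + 1) := by exact_mod_cast hss'.le
      have h2 : (s + 1 : ℝ) ≤ 80 * L := by exact_mod_cast hk2
      nlinarith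
    have h1 : (m * l : ℝ) ≤ m * (3 * Real.log n) := by gcongr
    have : (20 * (2310 * l * m) : ℝ) ≤ L := by nlinarith
    exact_mod_cast this
  have hε := edgeUnlikely (n := n) hd hn1
  have hne : (regularGraphs n d).Nonempty := regularGraphs_nonempty (by nlinarith) hnd
  have hwalk := sum_not_goodWalk_le (n := n) (l := l) (L := L) hd hε (by omega) (by omega)
  have hacyc : (edgeGraph (∅ : Finset (Sym2 (Fin n)))).IsAcyclic := by
    have : edgeGraph (∅ : Finset (Sym2 (Fin n))) = ⊥ := by simp [edgeGraph]
    rw [this]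
    exact isAcyclic_bot
  -- The depth is at most `2 * l + (2300 * l + 1) + (l + 2)`, so `2310 * l` queries suffice;
  -- bisection depth `l` is enough since `L ≤ n < 2 ^ l`.
  have hint := sum_interact_le (n := n) (d := d) (D := 2310 * l) (r := 100 * l) (R := 2300 * l)
    (k := k) (j := l) (m := m) (M := 2310 * l * m) (by omega) hε (by omega) (by omega) (by omega)
    hprobes (by omega) (by omega) A hAm (2310 * l) A.start ⟨[], ∅⟩ hacyc (by omega) (by simp)
    (by simp)
  simp only [containing_empty] at hint
  have h1 := walk_error_le hn1000 hnl.le (L := L) (by nlinarith) (by nlinarith)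
  have h2 := response_error_le (n := n) (d := d) (D := 2310 * l) (m := m) (s := s) (by omega) hss
    (by omega) (by nlinarith) (by omega) (by omega)
  refine le_trans ?_ (le_expectRegular hne A (strategy (100 * l) (2300 * l) k l (2310 * l)) τ
    h1 h2 hwalk hint)
  push_cast
  norm_num

end WalkAccess

end

theorem theorem4p11 :
    ∃ C : ℝ, ∀ d : ℕ, 3 ≤ d → ∃ (q : ℝ) (n₀ : ℕ), 0 < q ∧
      ∀ (n : ℕ) [NeZero n], n₀ ≤ n → Even (n * d) →
        ∃ (F : SimpleGraph (Fin n) → WalkAccess.PartialWalk n → Bool)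
          (Q : WalkAccess.AdaptiveSequence n),
          (Q.maxQueries : ℝ) ≤ C * Real.log n ∧
          ∀ A : WalkAccess.Algorithm n,
            (A.ProbesFewerThan (Real.sqrt n / (q * Real.log n)) →
              ∀ τ : SimpleGraph (Fin n) → WalkAccess.TimeRule n,
                0.99 ≤ WalkAccess.expectRegular n d fun G =>
                  |WalkAccess.evalDist (F G) (WalkAccess.trueAnswers G (τ G)) -
                    WalkAccess.evalDist (F G) (WalkAccess.responses G A Q)|) ∧
            ((∃ τ : SimpleGraph (Fin n) → WalkAccess.TimeRule n,
                WalkAccess.expectRegular n d (fun G =>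
                  WalkAccess.l1Dist (WalkAccess.responses G A Q)
                    (WalkAccess.trueAnswers G (τ G))) ≤ 0.99) →
              ¬ A.ProbesFewerThan (Real.sqrt n / (q * Real.log n))) := by
  open WalkAccess in
  -- `6930 = 3 * 2310`, from `l ≤ 3 * log n`.
  refine ⟨6930, fun d hd => ?_⟩
  obtain ⟨n₁, hn₁⟩ := exists_forall_mul_log_sq_le (200000 * 200000 * d)
  refine ⟨11200000, max n₁ (4 * ((d + 2) * d)), by norm_num, fun n _ hn hnd => ?_⟩
  have hn2 := hn₁ n ((le_max_left _ _).trans hn)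
  have hn1 := (le_max_right _ _).trans hn
  have hn3 : 3 ≤ n := by nlinarith
  set l := Nat.log 2 n + 1 with hl
  have hls : 200000 * l ≤ Nat.sqrt n := by
    rw [Nat.le_sqrt]
    refine le_trans ?_ hn2
    nlinarith [Nat.zero_le (l ^ 2)]
  obtain ⟨k, hk1, hk2⟩ := exists_scale (s := Nat.sqrt n) (R := 2300 * l) (by omega) (by omega)
  refine ⟨rejects (100 * l) (2300 * l * 2 ^ k),
    strategy (100 * l) (2300 * l) k l (2310 * l), ?_, fun A => ?_⟩
  · have := log_add_one_le hn3
    rw [← hl] at this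
    change ((2310 * l : ℕ) : ℝ) ≤ _
    push_cast
    linarith
  · have key := lower_bound hd hl hnd hn1 hn2 hk1 hk2 A
    refine ⟨fun hA τ => le_trans (by norm_num) (key hA τ), fun ⟨τ, hτ⟩ hA => ?_⟩
    have h1 := key hA τ
    have h2 : expectRegular n d (fun G =>
        |evalDist (rejects (100 * l) (2300 * l * 2 ^ k) G) (trueAnswers G (τ G)) -
          evalDist (rejects (100 * l) (2300 * l * 2 ^ k) G)
            (responses G A (strategy (100 * l) (2300 * l) k l (2310 * l)))|) ≤
        expectRegular n d fun G => l1Dist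
          (responses G A (strategy (100 * l) (2300 * l) k l (2310 * l)))
          (trueAnswers G (τ G)) := by
      unfold expectRegular
      gcongr
      exact abs_evalDist_sub_le _ _ _
    -- The bound `0.991` in `lower_bound`, stronger than the required `0.99`, makes this a
    -- contradiction.
    have := (h1.trans h2).trans hτ
    norm_num at this
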